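/- Let $q=p^m$ with $p$ prime and $m\ge 1$. For $k\ge 1$ let $R_k=\{x^k : x\in\mathbb{F}_q^*\}$. The generalized Paley graph $\Gamma(k,q)$ has vertex set $\mathbb{F}_q$ and an edge from $u$ to $v$ iff $v-u\in R_k$; the generalized Paley sum graph $\Gamma^+(k,q)$ has the same vertices and an edge from $u$ to $v$ iff $u+v\in R_k$ (loops are allowed and count once in the degree and in the adjacency matrix); $\bar\Gamma(k,q)$ is the loopless complement of $\Gamma(k,q)$. A connected $n$-regular undirected graph is called Ramanujan if every eigenvalue $\lambda$ of its adjacency matrix satisfies $|\lambda|=n$ or $|\lambda|\le 2\sqrt{n-1}$. The pair $(k,q)$ is called semiprimitive if either $k=2$ and $q\equiv 1\pmod 4$, or else $k>2$, $m$ is even, $k\mid p^t+1$ for some $t\mid \frac m2$, and $k\neq p^{m/2}+1$. **Theorem.** Let $q=p^m$ with $p$ prime and let $(k,q)$ be a semiprimitive pair. Then $\Gamma(k,q)$ is Ramanujan if and only if $\Gamma^+(k,q)$ is Ramanujan, and this happens if and only if - (a) $k=2$ and $q\equiv 1\pmod 4$ (so that $\Gamma(k,q)$ is the classic Paley graph),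 or $m$ is even and one of the following holds: - (b) $k=3$, $p=2$ and $m\ge 4$; - (c) $k=3$, $p\ne 2$, $p\equiv 2\pmod 3$ and $m\ge 2$; - (d) $k=4$, $p=3$ and $m\ge 4$; - (e) $k=4$, $p\neq 3$, $p\equiv 3\pmod 4$ and $m\ge 2$; - (f) $k=5$, $p=2$, $m\ge 8$ and $4\mid m$; - (g) $k=5$, $p\ne 2$, $p\equiv 2$ or $3\pmod 5$, $m\ge 4$ and $4\mid m$; - (h) $k=5$, $p\equiv 4\pmod 5$ and $m\ge 2$ even. Moreover, $\bar\Gamma(k,q)$ is Ramanujan for every semiprimitive pair $(k,q)$. -/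

import Mathlib

namespace GPGraph

/-- The Cayley digraph `X(G, S)`: an arrow from `u` to `v` whenever `v - u ∈ S`. -/
def cayley {G : Type*} [AddCommGroup G] (S : Set G) : Digraph G where
  Adj u v := v - u ∈ S

/-- The Cayley sum graph `X⁺(G, S)`: an arrow from `u` to `v` whenever `u + v ∈ S`
(loops may occur). -/
def cayleySum {G : Type*} [AddCommGroup G] (S : Set G) : Digraph G where
  Adj u v := u + v ∈ S

/-- The loopless complement of a digraph: `u → v` iff `u ≠ v` and there is no arrow `u → v`
in `G`. -/
def complement {V : Type*} (G : Digraph V) : Digraph V where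
  Adj u v := u ≠ v ∧ ¬ G.Adj u v

/-- The set `R_k = {x ^ k : x ∈ F, x ≠ 0}` of `k`-th powers of nonzero elements. -/
def powerSet (k : ℕ) (F : Type*) [Field F] : Set F :=
  {y | ∃ x : F, x ≠ 0 ∧ x ^ k = y}

/-- The generalized Paley graph `Γ(k, q)` on the field `F` with `q` elements. -/
def paley (k : ℕ) (F : Type*) [Field F] : Digraph F := cayley (powerSet k F)

/-- The generalized Paley sum graph `Γ⁺(k, q)` on the field `F` with `q` elements. -/
def paleySum (k : ℕ) (F : Type*) [Field F] : Digraph F := cayleySum (powerSet k F)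

/-- The real adjacency matrix of a digraph (a loop contributes `1` to the diagonal). -/
noncomputable def adjMatrix {V : Type*} (G : Digraph V) : Matrix V V ℝ :=
  open Classical in Matrix.of fun u v => if G.Adj u v then 1 else 0

/-- `G` is undirected: every arrow comes with its reverse. -/
def IsUndirected {V : Type*} (G : Digraph V) : Prop :=
  ∀ u v, G.Adj u v → G.Adj v u

/-- `G` is `n`-regular: all out-degrees and all in-degrees equal `n`
(a loop at a vertex counts once in each). -/
def IsRegular {V : Type*} (G : Digraph V) (n : ℕ) : Prop :=
  ∀ v, {w | G.Adj v w}.ncard = n ∧ {w | G.Adj w v}.ncard = n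

/-- `G` is (strongly) connected: nonempty, with a directed path between any two vertices. -/
def IsConnected {V : Type*} (G : Digraph V) : Prop :=
  Nonempty V ∧ ∀ u v, Relation.ReflTransGen G.Adj u v

/-- `μ` is an eigenvalue of `G`, i.e. of its adjacency matrix. -/
def IsEigenvalue {V : Type*} [Fintype V] [DecidableEq V] (G : Digraph V) (μ : ℝ) : Prop :=
  Module.End.HasEigenvalue (Matrix.toLin' (adjMatrix G)) μ

/-- `G` is a Ramanujan graph: it is undirected, connected and `n`-regular for some `n`, and each
eigenvalue `μ` has `|μ| = n` or `|μ| ≤ 2 √(n - 1)`. All eigenvalues are real here, because the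
adjacency matrix of an undirected graph is symmetric. -/
def IsRamanujan {V : Type*} [Fintype V] [DecidableEq V] (G : Digraph V) : Prop :=
  IsUndirected G ∧ IsConnected G ∧ ∃ n : ℕ, IsRegular G n ∧
    ∀ μ : ℝ, IsEigenvalue G μ → |μ| = n ∨ |μ| ≤ 2 * √((n : ℝ) - 1)

/-- `(k, q)` is a semiprimitive pair: `q = p ^ m` is a prime power and either `k = 2` and
`q ≡ 1 (mod 4)`, or `k > 2`, `m` is even, `k` divides `p ^ t + 1` for some divisor `t` of `m / 2`,
and `k ≠ p ^ (m / 2) + 1`. -/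
def IsSemiprimitivePair (k q : ℕ) : Prop :=
  ∃ p m : ℕ, p.Prime ∧ 0 < m ∧ q = p ^ m ∧
    ((k = 2 ∧ q ≡ 1 [MOD 4]) ∨
      (2 < k ∧ Even m ∧ (∃ t : ℕ, t ∣ m / 2 ∧ k ∣ p ^ t + 1) ∧ k ≠ p ^ (m / 2) + 1))

end GPGraph

/-! Write g(a) = Σ_x ψ(a x^k) for the trace character ψ, and n = (q-1)/k. Since -1 is a k-th power,
g is real. The nonprincipal eigenvalues of the Paley graph are (g(a)-1)/k with a ≠ 0, and those of
the sum graph agree with them up to sign, so one criterion governs both graphs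
(`isRamanujan_paley_iff`, `isRamanujan_paleySum_iff`).

Gauss sums are never evaluated. On nonzero elements g is constant on the k cosets aR_k, and two
moments (`sum_powSum`, `sum_powSum_sq`) show that the k coset values have sum 0 and square sum
k(k-1)q. Cauchy–Schwarz gives |g(a)| ≤ (k-1)√q (`rePowSum_sq_le`), and equality at a forces the
value -g(a)/(k-1) on every other coset (`rePowSum_eq_of_sq_eq`). Against the Ramanujan bound, the
upper estimate suffices when (k-1)² < 4k, that is for k ≤ 5, and for the complement it suffices for
every k.

For k ≥ 6 it remains to see that the extreme value is attained. For exponent p^t + 1 the sum comes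
from a Hermitian form and its square is computed directly (`powSum_sq_of_pow_eq_neg`); averaging
over cosets passes to each divisor k of p^t + 1 (`exists_rePowSum_sq_eq`). The exclusion k ≠ p^(m/2)
+ 1 yields k ≤ √q, which gives connectedness (`closure_powers`) and the numerical estimates. The
list (b)–(h) is then what semiprimitivity says for k = 3, 4, 5. -/

namespace GPGraph

open Finset

/-! ### Counting k-th powers and k-th roots in a finite field. -/

section FiniteFieldPowers

variable {F : Type*} [Field F] [Fintype F] [DecidableEq F]

theorem exists_generator (F : Type*) [Field F] [Fintype F] :
    ∃ ζ : F, IsPrimitiveRoot ζ (Fintype.card F - 1) ∧ ∀ x : F, x ≠ 0 → ∃ i : ℕ, x = ζ ^ i := by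
  obtain ⟨g, hg⟩ := IsCyclic.exists_generator (α := Fˣ)
  have ho : orderOf g = Fintype.card F - 1 := by
    rw [orderOf_eq_card_of_forall_mem_zpowers hg, Nat.card_units, Nat.card_eq_fintype_card]
  refine ⟨g, ?_, fun x hx => ?_⟩
  · rw [← ho, IsPrimitiveRoot.coe_units_iff]
    exact IsPrimitiveRoot.orderOf g
  · obtain ⟨i, hi⟩ := (mem_powers_iff_mem_zpowers (x := g)).2 (hg (Units.mk0 x hx))
    refine ⟨i, ?_⟩
    have := congrArg Units.val hi
    simpa using this.symm

theorem card_pow_eq_one {d : ℕ} (hd : d ∣ Fintype.card F - 1) :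
    #{x : F | x ^ d = 1} = d := by
  obtain ⟨ζ, hζ, -⟩ := exists_generator F
  have hq : 0 < Fintype.card F - 1 := by
    have := Fintype.one_lt_card (α := F); omega
  obtain ⟨e, he⟩ := hd
  have hd0 : 0 < d := Nat.pos_of_ne_zero (by rintro rfl; simp [he] at hq)
  have hp : IsPrimitiveRoot (ζ ^ e) d := hζ.pow hq (by rw [he, mul_comm])
  refine Eq.trans (congrArg card ?_) hp.card_nthRootsFinset
  ext x
  simp [Polynomial.mem_nthRootsFinset hd0]

theorem card_pow_eq_pow {k : ℕ} (hk : k ∣ Fintype.card F - 1) {z : F} (hz : z ≠ 0) :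
    #{x : F | x ^ k = z ^ k} = k := by
  conv_rhs => rw [← card_pow_eq_one hk]
  refine card_bij (fun x _ => x / z) ?_ ?_ ?_
  · intro x hx
    simp only [mem_filter, mem_univ, true_and] at hx ⊢
    rw [div_pow, hx, div_self (pow_ne_zero _ hz)]
  · intro x _ y _ h
    exact (div_left_inj' hz).1 h
  · intro x hx
    simp only [mem_filter, mem_univ, true_and] at hx
    exact ⟨x * z, by simp [mul_pow, hx], by field_simp⟩

omit [DecidableEq F] in
theorem exists_pow_eq {k n : ℕ} (h : Fintype.card F - 1 = k * n) {x : F} (hx : x ^ n = 1) :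
    ∃ y : F, y ≠ 0 ∧ y ^ k = x := by
  obtain ⟨ζ, hζ, hs⟩ := exists_generator F
  have hq : 0 < Fintype.card F - 1 := by
    have := Fintype.one_lt_card (α := F); omega
  have hn : n ≠ 0 := by rintro rfl; omega
  have hx0 : x ≠ 0 := by rintro rfl; simp [hn] at hx
  obtain ⟨i, rfl⟩ := hs x hx0
  rw [← pow_mul, hζ.pow_eq_one_iff_dvd, h] at hx
  obtain ⟨j, rfl⟩ := Nat.dvd_of_mul_dvd_mul_right (Nat.pos_of_ne_zero hn) hx
  exact ⟨ζ ^ j, pow_ne_zero _ (hζ.ne_zero hq.ne'), by rw [← pow_mul, mul_comm]⟩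

omit [DecidableEq F] in
theorem pow_pow_eq_one {k n : ℕ} (h : Fintype.card F - 1 = k * n) {y : F} (hy : y ≠ 0) :
    (y ^ k) ^ n = 1 := by
  rw [← pow_mul, ← h, FiniteField.pow_card_sub_one_eq_one y hy]

/-- The set of nonzero `k`-th powers as a finset. -/
def powers (k : ℕ) (F : Type*) [Field F] [Fintype F] [DecidableEq F] : Finset F :=
  (univ.filter (· ≠ 0)).image (· ^ k)

theorem mem_powers {k : ℕ} {y : F} : y ∈ powers k F ↔ ∃ x : F, x ≠ 0 ∧ x ^ k = y := by
  simp [powers]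

theorem coe_powers (k : ℕ) : (powers k F : Set F) = powerSet k F := by
  ext y
  simp [mem_powers, powerSet]

theorem sum_pow_eq {M : Type*} [AddCommMonoid M] {k : ℕ} (hk : k ∣ Fintype.card F - 1)
    (f : F → M) : ∑ x ∈ univ.filter (fun x : F => x ≠ 0), f (x ^ k) = k • ∑ y ∈ powers k F, f y := by
  rw [sum_comp f (· ^ k), smul_sum]
  refine sum_congr rfl fun y hy => ?_
  obtain ⟨z, hz, rfl⟩ := mem_powers.1 hy
  congr 1
  refine Eq.trans (congrArg card ?_) (card_pow_eq_pow hk hz)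
  rw [filter_filter]
  have hq : 0 < Fintype.card F - 1 := by
    have := Fintype.one_lt_card (α := F); omega
  have hk0 : k ≠ 0 := by rintro rfl; simp at hk; omega
  ext x
  simp only [mem_filter, mem_univ, true_and, and_iff_right_iff_imp]
  rintro h rfl
  rw [zero_pow hk0] at h
  exact pow_ne_zero _ hz h.symm

theorem card_filter_ne_zero : #{x : F | x ≠ 0} = Fintype.card F - 1 := by
  rw [filter_ne', card_erase_of_mem (mem_univ _), card_univ]

theorem card_powers {k n : ℕ} (h : Fintype.card F - 1 = k * n) : #(powers k F) = n := by
  have := sum_pow_eq (F := F) (k := k) ⟨n, h⟩ (fun _ => 1)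
  have hq : 0 < Fintype.card F - 1 := by
    have := Fintype.one_lt_card (α := F); omega
  have hk0 : 0 < k := Nat.pos_of_ne_zero (by rintro rfl; simp at h; omega)
  simp only [sum_const, smul_eq_mul, mul_one, card_filter_ne_zero, h] at this
  exact (Nat.eq_of_mul_eq_mul_left hk0 this).symm

theorem sum_univ_pow {M : Type*} [AddCommMonoid M] {k : ℕ} (hk : k ∣ Fintype.card F - 1)
    (f : F → M) : ∑ x : F, f (x ^ k) = f 0 + k • ∑ y ∈ powers k F, f y := by
  have hq : 0 < Fintype.card F - 1 := by
    have := Fintype.one_lt_card (α := F); omega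
  have hk0 : k ≠ 0 := by rintro rfl; simp at hk; omega
  rw [← sum_pow_eq hk, filter_ne', add_comm]
  rw [← sum_erase_add _ (fun x => f (x ^ k)) (mem_univ (0 : F)), zero_pow hk0]

end FiniteFieldPowers

/-! ### The trace character. -/

theorem charP_of_card_eq {F : Type*} [Field F] [Fintype F] {p m : ℕ} (hp : p.Prime)
    (hF : Fintype.card F = p ^ m) : CharP F p := by
  have hm : m ≠ 0 := by
    rintro rfl
    have := Fintype.one_lt_card (α := F)
    simp [hF] at this
  obtain ⟨r, hr⟩ := CharP.exists F
  obtain ⟨n, hrp, hn⟩ := FiniteField.card F r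
  rw [hF] at hn
  have : p = r := (Nat.prime_dvd_prime_iff_eq hp hrp).1
    (hp.dvd_of_dvd_pow (hn ▸ dvd_pow_self p hm))
  exact this ▸ hr

/-- The character is the absolute trace followed by the standard character of `ZMod p`. Frobenius
invariance and triviality on the elements with c^(p^t) = -c are what the Hermitian computation
needs. -/
theorem exists_primitive_addChar (F : Type*) [Field F] [Fintype F] {p m : ℕ} (hp : p.Prime)
    (hF : Fintype.card F = p ^ m) :
    ∃ ψ : AddChar F ℂ, ψ.IsPrimitive ∧ (∀ x, ψ (x ^ p) = ψ x) ∧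
      ∀ (t : ℕ) (c : F), 2 * t ∣ m → c ^ p ^ t = -c → ψ c = 1 := by
  classical
  have : Fact p.Prime := ⟨hp⟩
  have hc : CharP F p := charP_of_card_eq hp hF
  let _ : Algebra (ZMod p) F := ZMod.algebra F p
  have hfr : Module.finrank (ZMod p) F = m := by
    have h := Module.card_eq_pow_finrank (K := ZMod p) (V := F)
    rw [hF, ZMod.card] at h
    exact (Nat.pow_right_injective hp.two_le h).symm
  have htr := FiniteField.algebraMap_trace_eq_sum_pow (ZMod p) F
  simp only [hfr, Nat.card_eq_fintype_card, ZMod.card] at htr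
  have hinj := (algebraMap (ZMod p) F).injective
  let ψ : AddChar F ℂ :=
    (ZMod.stdAddChar (N := p)).compAddMonoidHom (Algebra.trace (ZMod p) F).toAddMonoidHom
  have hψ : ∀ x, ψ x = ZMod.stdAddChar (Algebra.trace (ZMod p) F x) := fun _ => rfl
  refine ⟨ψ, ?_, ?_, ?_⟩
  · apply AddChar.IsPrimitive.of_ne_one
    obtain ⟨b, hb⟩ := Algebra.trace_surjective (ZMod p) F 1
    refine AddChar.ne_one_iff.2 ⟨b, fun h => ?_⟩
    rw [hψ, hb, (ZMod.isPrimitive_stdAddChar p).zmod_char_eq_one_iff] at h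
    exact one_ne_zero h
  · intro x
    rw [hψ, hψ]
    congr 1
    apply hinj
    rw [htr, htr]
    have h1 := sum_range_succ (fun i => x ^ p ^ i) m
    have h2 := sum_range_succ' (fun i => x ^ p ^ i) m
    have h3 : x ^ p ^ m = x := by rw [← hF, FiniteField.pow_card]
    have h4 : ∀ i, (x ^ p) ^ p ^ i = x ^ p ^ (i + 1) := fun i => by
      rw [← pow_mul, pow_succ' p]
    simp only [h4]
    simp only [h3, pow_zero, pow_one] at h1 h2
    exact add_right_cancel (h2.symm.trans h1)
  · rintro t c ⟨s, hs⟩ h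
    rw [hψ]
    have : Algebra.trace (ZMod p) F c = 0 := by
      apply hinj
      rw [htr, map_zero, hs]
      -- Conjugates t places apart cancel, and 2t ∣ m lets blocks of length 2t fill the trace.
      have hneg : ∀ i, c ^ p ^ (t + i) = -c ^ p ^ i := fun i => by
        have := map_neg (iterateFrobenius F p i) c
        rw [iterateFrobenius_def, iterateFrobenius_def] at this
        rw [pow_add, pow_mul, h, this]
      have hblock : ∀ j, ∑ i ∈ range (2 * t * j), c ^ p ^ i = 0 := by
        intro j
        induction j with
        | zero => simp
        | succ j ih =>
          rw [show 2 * t * (j + 1) = 2 * t * j + t + t by ring, sum_range_add, sum_range_add, ih,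
            zero_add, ← sum_add_distrib]
          refine sum_eq_zero fun i _ => ?_
          rw [show 2 * t * j + t + i = t + (2 * t * j + i) by ring, hneg, add_neg_cancel]
      exact hblock s
    rw [this, AddChar.map_zero_eq_one]

/-! ### Power sums and their first two moments. -/

section PowerSums

variable {F : Type*} [Field F] [Fintype F]

/-- The exponential sum `∑ₓ ψ(a xᵏ)`. -/
noncomputable def powSum (ψ : AddChar F ℂ) (k : ℕ) (a : F) : ℂ := ∑ x : F, ψ (a * x ^ k)

theorem powSum_zero (ψ : AddChar F ℂ) (k : ℕ) : powSum ψ k 0 = Fintype.card F := by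
  simp [powSum]

theorem powSum_mul_pow (ψ : AddChar F ℂ) (k : ℕ) (a : F) {z : F} (hz : z ≠ 0) :
    powSum ψ k (a * z ^ k) = powSum ψ k a := by
  unfold powSum
  refine Fintype.sum_bijective (z * ·) (mulLeft_bijective₀ z hz) _ _ fun x => ?_
  rw [mul_pow, mul_assoc]

theorem powSum_conj (ψ : AddChar F ℂ) {k : ℕ} (hneg : ∃ z : F, z ^ k = -1) (hk : k ≠ 0) (a : F) :
    (starRingEnd ℂ) (powSum ψ k a) = powSum ψ k a := by
  obtain ⟨z, hz⟩ := hneg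
  have hz0 : z ≠ 0 := by rintro rfl; simp [hk] at hz
  conv_rhs => rw [← powSum_mul_pow ψ k a hz0, hz]
  simp only [powSum, map_sum, ← AddChar.map_neg_eq_conj]
  simp

variable [DecidableEq F]

theorem sum_powSum {ψ : AddChar F ℂ} (hψ : ψ.IsPrimitive) {k : ℕ} (hk : k ≠ 0) :
    ∑ a, powSum ψ k a = Fintype.card F := by
  unfold powSum
  rw [sum_comm]
  simp only [AddChar.sum_mulShift _ hψ, pow_eq_zero_iff hk]
  simp

theorem card_pow_add_pow_eq_zero {k : ℕ} (hk : k ∣ Fintype.card F - 1)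
    (hneg : ∃ z : F, z ^ k = -1) {x : F} (hx : x ≠ 0) : #{y : F | x ^ k + y ^ k = 0} = k := by
  obtain ⟨z, hz⟩ := hneg
  have hk0 : k ≠ 0 := by
    have := Fintype.one_lt_card (α := F)
    rintro rfl
    simp at hk; omega
  have hz0 : z ≠ 0 := by rintro rfl; simp [hk0] at hz
  refine Eq.trans (congrArg card ?_) (card_pow_eq_pow hk (mul_ne_zero hz0 hx))
  ext y
  simp only [mem_filter, mem_univ, true_and, mul_pow, hz]
  constructor <;> intro h <;> linear_combination h

/-- By orthogonality the second moment is q times the number of solutions of x^k + y^k = 0. There is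
one with x = 0, and k for each x ≠ 0 because -1 is a k-th power. -/
theorem sum_powSum_sq {ψ : AddChar F ℂ} (hψ : ψ.IsPrimitive) {k : ℕ}
    (hk : k ∣ Fintype.card F - 1) (hneg : ∃ z : F, z ^ k = -1) :
    ∑ a, powSum ψ k a ^ 2 = Fintype.card F * (1 + ((Fintype.card F : ℂ) - 1) * k) := by
  have hq := Fintype.one_lt_card (α := F)
  have hk0 : k ≠ 0 := by
    rintro rfl
    simp at hk; omega
  have h1 : ∀ a, powSum ψ k a ^ 2 = ∑ x : F, ∑ y : F, ψ (a * (x ^ k + y ^ k)) := by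
    intro a
    simp only [sq, powSum, sum_mul_sum, mul_add, AddChar.map_add_eq_mul]
  have h2 : ∀ x : F, ∑ y : F, ∑ a : F, ψ (a * (x ^ k + y ^ k))
      = Fintype.card F * (#{y : F | x ^ k + y ^ k = 0} : ℂ) := by
    intro x
    simp only [AddChar.sum_mulShift _ hψ]
    rw [← Nat.cast_sum, ← sum_filter, sum_const, smul_eq_mul, mul_comm]
    push_cast
    rfl
  have h3 : #{y : F | (0 : F) ^ k + y ^ k = 0} = 1 := by
    simp [hk0, filter_eq']
  simp only [h1]
  rw [sum_comm]
  simp only [sum_comm (s := univ) (t := univ) (f := fun (a : F) (y : F) => ψ (a * (_ ^ k + y ^ k)))]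
  simp only [h2]
  rw [← mul_sum, ← sum_erase_add _ _ (mem_univ (0 : F)), h3]
  rw [sum_congr rfl (g := fun _ => (k : ℂ)) (fun x hx => by
    rw [card_pow_add_pow_eq_zero hk hneg (ne_of_mem_erase hx)])]
  rw [sum_const, card_erase_of_mem (mem_univ _), card_univ, nsmul_eq_mul, Nat.cast_sub hq.le]
  push_cast
  ring

end PowerSums

/-! ### The Cauchy–Schwarz bound and the attainment of equality. -/

section PowerSums

variable {F : Type*} [Field F] [Fintype F] [DecidableEq F]

/-- The real part of `powSum`. -/
noncomputable def rePowSum (ψ : AddChar F ℂ) (k : ℕ) (a : F) : ℝ := (powSum ψ k a).re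

omit [DecidableEq F] in
theorem powSum_eq_ofReal (ψ : AddChar F ℂ) {k : ℕ} (hneg : ∃ z : F, z ^ k = -1) (hk : k ≠ 0)
    (a : F) : powSum ψ k a = (rePowSum ψ k a : ℂ) :=
  (Complex.conj_eq_iff_re.1 (powSum_conj ψ hneg hk a)).symm

omit [DecidableEq F] in
theorem rePowSum_mul_pow (ψ : AddChar F ℂ) (k : ℕ) (a : F) {z : F} (hz : z ≠ 0) :
    rePowSum ψ k (a * z ^ k) = rePowSum ψ k a := by
  rw [rePowSum, powSum_mul_pow ψ k a hz, rePowSum]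

/-- This is Cauchy–Schwarz with its defect made explicit: the coset values have mean 0, so those off
aR_k have mean -g(a)/(k-1), and the left side is their scaled variance. Nonnegativity gives the
bound, vanishing gives the equality case. -/
theorem sum_sq_rePowSum {ψ : AddChar F ℂ} (hψ : ψ.IsPrimitive) {k n : ℕ}
    (h : Fintype.card F - 1 = k * n) (hneg : ∃ z : F, z ^ k = -1) {a : F} (ha : a ≠ 0) :
    ∑ c ∈ (univ.erase 0) \ (powers k F).image (a * ·),
        (((k : ℝ) - 1) * rePowSum ψ k c + rePowSum ψ k a) ^ 2 =
      n * k * (k - 1) * ((k - 1) ^ 2 * Fintype.card F - rePowSum ψ k a ^ 2) := by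
  have hq := Fintype.one_lt_card (α := F)
  have hk0 : k ≠ 0 := by
    rintro rfl
    simp at h; omega
  have hqr : (Fintype.card F : ℝ) - 1 = k * n := by
    rw [← Nat.cast_mul, ← h, Nat.cast_sub hq.le, Nat.cast_one]
  have hg := powSum_eq_ofReal ψ hneg hk0
  set g := rePowSum ψ k with hgdef
  have s1 : ∑ c, g c = Fintype.card F := by
    have := sum_powSum hψ hk0
    simp only [hg] at this
    exact_mod_cast this
  have s2 : ∑ c, g c ^ 2 = Fintype.card F * (1 + ((Fintype.card F : ℝ) - 1) * k) := by
    have := sum_powSum_sq hψ ⟨n, h⟩ hneg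
    simp only [hg] at this
    exact_mod_cast this
  have g0 : g 0 = Fintype.card F := by
    have := powSum_zero ψ k
    rw [hg] at this
    exact_mod_cast this
  have hsub : (powers k F).image (a * ·) ⊆ univ.erase 0 := by
    intro c hc
    obtain ⟨y, hy, rfl⟩ := mem_image.1 hc
    obtain ⟨z, hz, rfl⟩ := mem_powers.1 hy
    exact mem_erase.2 ⟨mul_ne_zero ha (pow_ne_zero _ hz), mem_univ _⟩
  have hcard : #((powers k F).image (a * ·)) = n := by
    rw [card_image_of_injective _ (mul_right_injective₀ ha), card_powers h]
  have hconst : ∀ c ∈ (powers k F).image (a * ·), g c = g a := by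
    intro c hc
    obtain ⟨y, hy, rfl⟩ := mem_image.1 hc
    obtain ⟨z, hz, rfl⟩ := mem_powers.1 hy
    exact rePowSum_mul_pow ψ k a hz
  have key : ∀ f : ℝ → ℝ, ∑ c ∈ (univ.erase 0) \ (powers k F).image (a * ·), f (g c)
      = ∑ c, f (g c) - f (Fintype.card F) - n * f (g a) := by
    intro f
    have e1 := sum_sdiff (f := fun c => f (g c)) hsub
    have e2 := sum_erase_add univ (fun c => f (g c)) (mem_univ (0 : F))
    have e3 : ∑ c ∈ (powers k F).image (a * ·), f (g c) = n * f (g a) := by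
      rw [sum_congr rfl (fun c hc => by rw [hconst c hc]), sum_const, hcard, nsmul_eq_mul]
    rw [g0] at e2
    linarith
  rw [key (fun x => ((k - 1) * x + g a) ^ 2)]
  have e : ∑ c, (((k : ℝ) - 1) * g c + g a) ^ 2
      = (k - 1) ^ 2 * ∑ c, g c ^ 2 + 2 * (k - 1) * g a * ∑ c, g c + Fintype.card F * g a ^ 2 := by
    rw [mul_sum, mul_sum, ← sum_add_distrib]
    rw [show (Fintype.card F : ℝ) * g a ^ 2 = ∑ _c : F, g a ^ 2 by simp, ← sum_add_distrib]
    exact sum_congr rfl fun c _ => by ring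
  rw [e, s1, s2]
  have hqr' : (Fintype.card F : ℝ) = k * n + 1 := by linarith
  rw [hqr']
  ring

theorem rePowSum_sq_le {ψ : AddChar F ℂ} (hψ : ψ.IsPrimitive) {k n : ℕ} (hk : 2 ≤ k)
    (h : Fintype.card F - 1 = k * n) (hneg : ∃ z : F, z ^ k = -1) {a : F} (ha : a ≠ 0) :
    rePowSum ψ k a ^ 2 ≤ (k - 1) ^ 2 * Fintype.card F := by
  have hq := Fintype.one_lt_card (α := F)
  have hn : 0 < n := Nat.pos_of_ne_zero (by rintro rfl; omega)
  have hs := sum_sq_rePowSum hψ h hneg ha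
  have h0 : 0 ≤ ∑ c ∈ (univ.erase 0) \ (powers k F).image (a * ·),
        (((k : ℝ) - 1) * rePowSum ψ k c + rePowSum ψ k a) ^ 2 := sum_nonneg fun _ _ => sq_nonneg _
  rw [hs] at h0
  have hk' : (2 : ℝ) ≤ k := by exact_mod_cast hk
  have hn' : (0 : ℝ) < n := by exact_mod_cast hn
  have : 0 < (n : ℝ) * k * (k - 1) := by
    have : (0 : ℝ) < k - 1 := by linarith
    positivity
  have := nonneg_of_mul_nonneg_right h0 this
  linarith

theorem rePowSum_eq_of_sq_eq {ψ : AddChar F ℂ} (hψ : ψ.IsPrimitive) {k n : ℕ}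
    (h : Fintype.card F - 1 = k * n) (hneg : ∃ z : F, z ^ k = -1) {a : F} (ha : a ≠ 0)
    (hsq : rePowSum ψ k a ^ 2 = (k - 1) ^ 2 * Fintype.card F) {c : F} (hc : c ≠ 0)
    (hca : ∀ y ∈ powers k F, c ≠ a * y) :
    ((k : ℝ) - 1) * rePowSum ψ k c = -rePowSum ψ k a := by
  have hs := sum_sq_rePowSum hψ h hneg ha
  rw [hsq, sub_self, mul_zero, sum_eq_zero_iff_of_nonneg (fun _ _ => sq_nonneg _)] at hs
  have := hs c (by
    simp only [mem_sdiff, mem_erase, mem_univ, and_true, mem_image, not_exists, not_and]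
    exact ⟨hc, fun y hy e => hca y hy e.symm⟩)
  have := pow_eq_zero_iff two_ne_zero |>.1 this
  linarith

/-- The averaging relation between exponential sums of exponents `k` and `k * N`. -/
theorem sum_powSum_mul (ψ : AddChar F ℂ) (k N : ℕ) (hkN : k * N ≠ 0) (a : F) :
    ∑ x ∈ univ.filter (fun x : F => x ≠ 0), powSum ψ (k * N) (a * x ^ k) =
      ((Fintype.card F : ℂ) - 1) * powSum ψ k a := by
  have hq := Fintype.one_lt_card (α := F)
  have hk : k ≠ 0 := by rintro rfl; simp at hkN
  have hN : N ≠ 0 := by rintro rfl; simp at hkN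
  unfold powSum
  rw [sum_comm, ← sum_erase_add _ _ (mem_univ (0 : F))]
  -- For z ≠ 0 the substitution x ↦ z^N x absorbs z^(kN); the omitted x = 0 accounts for the -1.
  have hz : ∀ z ∈ univ.erase (0 : F),
      ∑ x ∈ univ.filter (fun x : F => x ≠ 0), ψ (a * x ^ k * z ^ (k * N))
        = powSum ψ k a - 1 := by
    intro z hz
    have hz := ne_of_mem_erase hz
    have : powSum ψ k a = ∑ x, ψ (a * x ^ k * z ^ (k * N)) := by
      rw [← powSum_mul_pow ψ k a (pow_ne_zero N hz)]
      refine sum_congr rfl fun x _ => ?_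
      rw [← pow_mul, mul_comm N k]; congr 1; ring
    rw [this, filter_ne', ← sum_erase_add _ _ (mem_univ (0 : F))]
    simp [hk]
  rw [sum_congr rfl hz]
  simp only [zero_pow hkN, mul_zero, AddChar.map_zero_eq_one, sum_const, card_filter_ne_zero,
    card_erase_of_mem (mem_univ (0 : F)), card_univ, nsmul_eq_mul, mul_one]
  rw [Nat.cast_sub hq.le, Nat.cast_one]
  unfold powSum
  ring

theorem card_pow_eq_self {d : ℕ} (hd : 1 < d) (hdq : d - 1 ∣ Fintype.card F - 1) :
    #{u : F | u ^ d = u} = d := by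
  have h : ({u : F | u ^ d = u} : Finset F) = insert 0 ({u : F | u ^ (d - 1) = 1} : Finset F) := by
    ext u
    simp only [mem_filter, mem_univ, true_and, mem_insert]
    obtain ⟨e, rfl⟩ : ∃ e, d = e + 1 := ⟨d - 1, by omega⟩
    rw [Nat.add_sub_cancel, pow_succ]
    by_cases hu : u = 0
    · simp [hu]
    · simp [hu]
  rw [h, card_insert_of_notMem, card_pow_eq_one hdq]
  · omega
  · simp [Nat.sub_ne_zero_of_lt hd]

/-- The case of exponent `Q + 1`, a Hermitian form with maximal radical. -/
theorem powSum_sq_of_pow_eq_neg {ψ : AddChar F ℂ} (hψ : ψ.IsPrimitive) {p t m : ℕ}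
    (hp : p.Prime) (hF : Fintype.card F = p ^ m) (ht : 2 * t ∣ m)
    (hfrob : ∀ x, ψ (x ^ p) = ψ x)
    (hone : ∀ c : F, c ^ p ^ t = -c → ψ c = 1) (hneg : ∃ z : F, z ^ (p ^ t + 1) = -1)
    {a : F} (ha : a ≠ 0) (hap : a ^ p ^ t = -a) :
    powSum ψ (p ^ t + 1) a ^ 2 = Fintype.card F * (p : ℂ) ^ (2 * t) := by
  have hq := Fintype.one_lt_card (α := F)
  have : Fact p.Prime := ⟨hp⟩
  have : CharP F p := charP_of_card_eq hp hF
  have hfrob' : ∀ (j : ℕ) (x : F), ψ (x ^ p ^ j) = ψ x := by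
    intro j x
    induction j with
    | zero => simp
    | succ j ih => rw [pow_succ, pow_mul, hfrob, ih]
  have ht0 : t ≠ 0 := by
    rintro rfl
    rw [mul_zero, zero_dvd_iff] at ht
    simp [hF, ht] at hq
  have hQQ : p ^ t * p ^ t = p ^ (2 * t) := by rw [← pow_add, two_mul]
  obtain ⟨z, hz⟩ := hneg
  have hz0 : z ≠ 0 := by rintro rfl; simp at hz
  have hbij : Function.Bijective (fun y : F => y ^ p ^ t) := by
    rw [← Finite.injective_iff_bijective]
    exact (iterateFrobenius F p t).injective
  -- With Q = p^t: since -1 is a (Q+1)-th power, one factor may be negated. Putting x = y + u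
  -- cancels the terms in y alone, and Frobenius invariance turns a·y·u^Q into -a·y^Q·u^(Q²), so the
  -- exponent becomes additive in y^Q.
  have h1 : powSum ψ (p ^ t + 1) a ^ 2
      = ∑ u : F, ∑ y : F, ψ (a * u ^ (p ^ t + 1)) * ψ (y ^ p ^ t * (a * (u - u ^ p ^ (2 * t)))) := by
    have e : powSum ψ (p ^ t + 1) a = ∑ y, ψ (-(a * y ^ (p ^ t + 1))) := by
      conv_lhs => rw [← powSum_mul_pow ψ _ a hz0, hz]
      simp [powSum]
    rw [sq]
    nth_rewrite 2 [e]
    unfold powSum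
    rw [sum_mul_sum, sum_comm]
    conv_rhs => rw [sum_comm]
    refine sum_congr rfl fun y _ => ?_
    rw [← Equiv.sum_comp (Equiv.addLeft y)]
    refine sum_congr rfl fun u _ => ?_
    rw [Equiv.coe_addLeft, ← AddChar.map_add_eq_mul]
    have e1 : a * (y + u) ^ (p ^ t + 1) + -(a * y ^ (p ^ t + 1))
        = a * u ^ (p ^ t + 1) + a * y * u ^ p ^ t + y ^ p ^ t * (a * u) := by
      rw [pow_succ, add_pow_char_pow]
      ring
    have e2 : ψ (a * y * u ^ p ^ t) = ψ (-(y ^ p ^ t * (a * u ^ p ^ (2 * t)))) := by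
      rw [← hfrob' t, mul_pow, mul_pow, hap, ← pow_mul, hQQ]
      congr 1
      ring
    rw [e1, AddChar.map_add_eq_mul, AddChar.map_add_eq_mul, e2, mul_assoc,
      ← AddChar.map_add_eq_mul]
    congr 2
    ring
  have h2 : ∀ u : F, ∑ y : F, ψ (a * u ^ (p ^ t + 1)) *
      ψ (y ^ p ^ t * (a * (u - u ^ p ^ (2 * t))))
      = if u ^ p ^ (2 * t) = u then (Fintype.card F : ℂ) else 0 := by
    intro u
    rw [← mul_sum, hbij.sum_comp (fun y => ψ (y * (a * (u - u ^ p ^ (2 * t))))),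
      AddChar.sum_mulShift _ hψ]
    simp only [mul_eq_zero, ha, false_or, sub_eq_zero, eq_comm (a := u)]
    split_ifs with hu
    -- On the surviving u, those with u^(Q²) = u, the element c = a·u^(Q+1) satisfies c^Q = -c, so ψ
    -- is trivial there; Q² such u remain.
    · rw [hone, one_mul]
      rw [mul_pow, hap, ← pow_mul, add_mul, hQQ, one_mul, pow_add, hu, pow_succ']
      ring
    · simp
  rw [h1, sum_congr rfl fun u _ => h2 u, ← sum_filter, sum_const, card_pow_eq_self]
  · rw [nsmul_eq_mul, mul_comm]; push_cast; rfl
  · exact Nat.one_lt_pow (by omega) hp.one_lt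
  · obtain ⟨s, rfl⟩ := ht
    rw [hF, pow_mul p (2 * t) s]
    simpa using Nat.sub_dvd_pow_sub_pow (p ^ (2 * t)) 1 s

/-- Existence of a large exponential sum for exponents dividing `p ^ t + 1`. -/
theorem exists_rePowSum_sq_eq {ψ : AddChar F ℂ} (hψ : ψ.IsPrimitive) {p t m k : ℕ}
    (hp : p.Prime) (hF : Fintype.card F = p ^ m) (ht : 2 * t ∣ m)
    (hfrob : ∀ x, ψ (x ^ p) = ψ x)
    (hone : ∀ c : F, c ^ p ^ t = -c → ψ c = 1) (hneg : ∃ z : F, z ^ (p ^ t + 1) = -1)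
    {a : F} (ha : a ≠ 0) (hap : a ^ p ^ t = -a) (hk : k ∣ p ^ t + 1) :
    rePowSum ψ k a ^ 2 = (k - 1) ^ 2 * Fintype.card F := by
  have hq := Fintype.one_lt_card (α := F)
  have hnegk : ∃ z : F, z ^ k = -1 := by
    obtain ⟨N, hN⟩ := hk
    obtain ⟨z, hz⟩ := hneg
    exact ⟨z ^ N, by rw [← pow_mul, mul_comm, ← hN, hz]⟩
  have hdvd : p ^ t + 1 ∣ Fintype.card F - 1 := by
    obtain ⟨s, rfl⟩ := ht
    rw [hF, pow_mul p (2 * t) s]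
    refine dvd_trans ?_ (Nat.sub_dvd_pow_sub_pow (p ^ (2 * t)) 1 s |>.trans (by simp))
    refine ⟨p ^ t - 1, ?_⟩
    rw [← Nat.sq_sub_sq, ← pow_mul, mul_comm t 2, one_pow]
  obtain ⟨n, hn⟩ := hdvd
  have hsq := powSum_sq_of_pow_eq_neg hψ hp hF ht hfrob hone hneg ha hap
  obtain ⟨N, hN⟩ := hk
  have hkN : k * N ≠ 0 := by omega
  have hk0 : k ≠ 0 := by rintro rfl; simp at hkN
  have hN0 : N ≠ 0 := by rintro rfl; simp at hkN
  rw [powSum_eq_ofReal ψ hneg (by omega)] at hsq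
  have hsq' : rePowSum ψ (p ^ t + 1) a ^ 2
      = (((p ^ t + 1 : ℕ) : ℝ) - 1) ^ 2 * Fintype.card F := by
    have : rePowSum ψ (p ^ t + 1) a ^ 2 = Fintype.card F * (p : ℝ) ^ (2 * t) := by
      exact_mod_cast hsq
    rw [this]; push_cast; ring
  have hother := fun c => rePowSum_eq_of_sq_eq hψ hn hneg ha hsq' (c := c)
  have havg := sum_powSum_mul ψ k N hkN a
  rw [← hN, powSum_eq_ofReal ψ hnegk hk0] at havg
  simp only [powSum_eq_ofReal ψ hneg (Nat.succ_ne_zero _)] at havg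
  have havg' : ∑ x ∈ univ.filter (fun x : F => x ≠ 0), rePowSum ψ (p ^ t + 1) (a * x ^ k)
      = ((Fintype.card F : ℝ) - 1) * rePowSum ψ k a := by exact_mod_cast havg
  set g := rePowSum ψ (p ^ t + 1) with hg
  have hkn : k * n ∣ Fintype.card F - 1 := ⟨N, by rw [hn, hN]; ring⟩
  have hn0 : n ≠ 0 := by rintro rfl; omega
  -- the terms with `x ^ k` a `(p ^ t + 1)`-th power
  have hval : ∀ x ∈ univ.filter (fun x : F => x ≠ 0), (p : ℝ) ^ t * g (a * x ^ k)
      = -g a + if x ^ (k * n) = 1 then ((p : ℝ) ^ t + 1) * g a else 0 := by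
    intro x hx
    have hx : x ≠ 0 := by simpa using hx
    split_ifs with h1
    · rw [pow_mul] at h1
      obtain ⟨y, hy, hyx⟩ := exists_pow_eq hn h1
      rw [← hyx, hg, rePowSum_mul_pow ψ _ a hy]
      ring
    · have := hother (a * x ^ k) (mul_ne_zero ha (pow_ne_zero _ hx)) (by
        intro y hy e
        obtain ⟨z, hz, rfl⟩ := mem_powers.1 hy
        apply h1
        rw [pow_mul, mul_left_cancel₀ ha e, pow_pow_eq_one hn hz])
      push_cast at this
      linarith
  have hsum := sum_congr rfl hval
  -- The condition x^(kn) = 1 says that x^k is a (p^t+1)-th power, so kn of the q - 1 terms take the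
  -- extreme value and the rest take -g(a)/p^t.
  have hcount : #{x ∈ univ.filter (fun x : F => x ≠ 0) | x ^ (k * n) = 1} = k * n := by
    refine Eq.trans (congrArg card ?_) (card_pow_eq_one hkn)
    rw [filter_filter]
    ext x
    simp only [mem_filter, mem_univ, true_and, and_iff_right_iff_imp]
    rintro h rfl
    simp [hk0, hn0] at h
  rw [← mul_sum, havg', sum_add_distrib, ← sum_filter, sum_const, sum_const, hcount,
    card_filter_ne_zero, nsmul_eq_mul, nsmul_eq_mul, Nat.cast_sub hq.le] at hsum
  have hqr : (Fintype.card F : ℝ) - 1 = (p ^ t + 1) * n := by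
    have : ((Fintype.card F - 1 : ℕ) : ℝ) = ((p ^ t + 1) * n : ℕ) := by rw [hn]
    rw [Nat.cast_sub hq.le] at this
    push_cast at this
    exact this
  push_cast at hsum
  rw [hqr] at hsum
  have hn' : (n : ℝ) ≠ 0 := by exact_mod_cast hn0
  have hQ' : ((p : ℝ) ^ t + 1) ≠ 0 := by positivity
  have hfin : (p : ℝ) ^ t * rePowSum ψ k a = (k - 1) * g a := by
    apply mul_left_cancel₀ (mul_ne_zero hQ' hn')
    linarith
  have hp0 : (p : ℝ) ^ t ≠ 0 := pow_ne_zero _ (by exact_mod_cast hp.ne_zero)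
  apply mul_left_cancel₀ (pow_ne_zero 2 hp0)
  push_cast at hsq'
  linear_combination (p ^ t * rePowSum ψ k a + (k - 1) * g a) * hfin + (k - 1 : ℝ) ^ 2 * hsq'

end PowerSums

/-! ### Additive generation by k-th powers. -/

section Generation

variable {F : Type*} [Field F] [Fintype F] [DecidableEq F]

/-- The nonzero `k`-th powers as a submonoid. -/
def powersSubmonoid (k : ℕ) (F : Type*) [Field F] [Fintype F] [DecidableEq F] : Submonoid F where
  carrier := powers k F
  one_mem' := mem_coe.2 (mem_powers.2 ⟨1, one_ne_zero, one_pow k⟩)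
  mul_mem' := by
    intro a b ha hb
    obtain ⟨x, hx, rfl⟩ := mem_powers.1 ha
    obtain ⟨y, hy, rfl⟩ := mem_powers.1 hb
    exact mem_powers.2 ⟨x * y, mul_ne_zero hx hy, mul_pow x y k⟩

theorem neg_mem_powers {k : ℕ} (hk : k ≠ 0) (hneg : ∃ z : F, z ^ k = -1) {y : F}
    (hy : y ∈ powers k F) : -y ∈ powers k F := by
  obtain ⟨z, hz⟩ := hneg
  obtain ⟨x, hx, rfl⟩ := mem_powers.1 hy
  have hz0 : z ≠ 0 := by rintro rfl; simp [hk] at hz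
  exact mem_powers.2 ⟨z * x, mul_ne_zero hz0 hx, by rw [mul_pow, hz, neg_one_mul]⟩

/-- The additive closure T of R_k is a subfield. If it were proper, then |T|² ≤ q while |T| ≥ n + 1,
so n + 2 ≤ k, against k² ≤ q = kn + 1. -/
theorem closure_powers {k n : ℕ} (hk : 2 ≤ k) (h : Fintype.card F - 1 = k * n)
    (hneg : ∃ z : F, z ^ k = -1) (hkq : k ^ 2 ≤ Fintype.card F) :
    AddSubmonoid.closure (powers k F : Set F) = ⊤ := by
  have hq := Fintype.one_lt_card (α := F)
  set T : Subsemiring F := (powersSubmonoid k F).subsemiringClosure with hT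
  have hTc : (T : Set F) = AddSubmonoid.closure (powers k F : Set F) :=
    Submonoid.subsemiringClosure_coe _
  have hsub : ∀ y ∈ powers k F, y ∈ T := fun y hy =>
    (Submonoid.subsemiringClosure_mem _).2 (AddSubmonoid.subset_closure hy)
  suffices hall : ∀ x : F, x ∈ T by
    rw [eq_top_iff]
    intro x _
    have : x ∈ (T : Set F) := hall x
    rwa [hTc] at this
  classical
  by_contra! hx
  obtain ⟨x, hx⟩ := hx
  have hm1 : (-1 : F) ∈ T :=
    hsub _ (neg_mem_powers (by omega) hneg (mem_powers.2 ⟨1, one_ne_zero, one_pow k⟩))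
  have hnegT : ∀ y ∈ T, -y ∈ T := fun y hy => by simpa using T.mul_mem hm1 hy
  have hinv : ∀ y ∈ T, y⁻¹ ∈ T := by
    intro y hy
    by_cases hy0 : y = 0
    · simp [hy0]
    · have : y⁻¹ = y ^ (Fintype.card F - 2) := by
        apply inv_eq_of_mul_eq_one_left
        rw [← pow_succ, show Fintype.card F - 2 + 1 = Fintype.card F - 1 by omega,
          FiniteField.pow_card_sub_one_eq_one y hy0]
      rw [this]
      exact T.pow_mem hy _
  let TF : Finset F := univ.filter (· ∈ T)
  -- For x outside T, the elements 1 and x are linearly independent over T.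
  have hcardle : #TF * #TF ≤ Fintype.card F := by
    rw [← card_product, ← card_univ]
    refine card_le_card_of_injOn (fun y => y.1 + x * y.2) (fun _ _ => mem_coe.2 (mem_univ _)) ?_
    rintro ⟨a, b⟩ hab ⟨c, d⟩ hcd e
    simp only [coe_product, Set.mem_prod, mem_coe, TF, mem_filter, mem_univ, true_and] at hab hcd e
    have hbd : b = d := by
      by_contra hbd
      apply hx
      have hbd' : b - d ≠ 0 := sub_ne_zero.2 hbd
      have : x = (c + -a) * (b + -d)⁻¹ := by
        rw [← sub_eq_add_neg, ← sub_eq_add_neg, eq_mul_inv_iff_mul_eq₀ hbd']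
        linear_combination e
      rw [this]
      exact T.mul_mem (T.add_mem hcd.1 (hnegT _ hab.1))
        (hinv _ (T.add_mem hab.2 (hnegT _ hcd.2)))
    subst hbd
    rw [add_right_cancel e]
  have hcardge : n + 1 ≤ #TF := by
    rw [← card_powers h, ← card_insert_of_notMem (a := 0) (s := powers k F)]
    · refine card_le_card fun y hy => ?_
      simp only [TF, mem_filter, mem_univ, true_and]
      rcases mem_insert.1 hy with rfl | hy
      · exact T.zero_mem
      · exact hsub _ hy
    · intro h0
      obtain ⟨z, hz, hz0⟩ := mem_powers.1 h0
      exact pow_ne_zero _ hz hz0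
  have h1 : (n + 1) * (n + 1) ≤ k * n + 1 := by
    calc _ ≤ #TF * #TF := Nat.mul_le_mul hcardge hcardge
      _ ≤ Fintype.card F := hcardle
      _ = k * n + 1 := by omega
  have h2 : k ^ 2 ≤ k * n + 1 := by omega
  have h3 : n + 2 ≤ k := by
    by_contra hlt
    have hn : 0 < n := Nat.pos_of_ne_zero (by rintro rfl; omega)
    have : k * n ≤ (n + 1) * n := Nat.mul_le_mul_right n (by omega)
    nlinarith
  nlinarith

omit [Fintype F] [DecidableEq F] in
theorem closure_of_mul_subset {S : Set F} {s : Set F} (hs : AddSubmonoid.closure s = ⊤) {g : F}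
    (hg : g ≠ 0) (h : ∀ y ∈ s, g * y ∈ S) : AddSubmonoid.closure S = ⊤ := by
  rw [eq_top_iff]
  intro x _
  have key : ∀ y ∈ AddSubmonoid.closure s, g * y ∈ AddSubmonoid.closure S := by
    intro y hy
    induction hy using AddSubmonoid.closure_induction with
    | mem y hy => exact AddSubmonoid.subset_closure (h y hy)
    | zero => simp
    | add a b _ _ iha ihb => rw [mul_add]; exact add_mem iha ihb
  have := key (g⁻¹ * x) (hs ▸ AddSubmonoid.mem_top _)
  rwa [mul_inv_cancel_left₀ hg] at this

end Generation

/-! ### Connectedness and spectra of Cayley graphs and Cayley sum graphs. -/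

section CayleyGraphs

theorem cayley_isConnected {G : Type*} [AddCommGroup G] {S : Set G}
    (hS : AddSubmonoid.closure S = ⊤) : IsConnected (cayley S) := by
  refine ⟨⟨0⟩, fun u v => ?_⟩
  have key : ∀ d ∈ AddSubmonoid.closure S, ∀ u,
      Relation.ReflTransGen (cayley S).Adj u (u + d) := by
    intro d hd
    induction hd using AddSubmonoid.closure_induction with
    | mem d hd => exact fun u => .single (by simpa [cayley] using hd)
    | zero => exact fun u => by rw [add_zero]
    | add a b _ _ iha ihb => exact fun u => by rw [← add_assoc]; exact (iha u).trans (ihb _)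
  have := key (v - u) (hS ▸ AddSubmonoid.mem_top _) u
  rwa [add_sub_cancel] at this

/-- Two steps u → -d-u → u+2d realise translation by 2d, which is enough when 2 is invertible. In
characteristic 2 sums are differences and the graph is the Cayley graph. -/
theorem cayleySum_isConnected {F : Type*} [Field F] {S : Set F}
    (hS : AddSubmonoid.closure S = ⊤) (hneg : ∀ s ∈ S, -s ∈ S) : IsConnected (cayleySum S) := by
  by_cases h2 : (2 : F) = 0
  · have : cayleySum S = cayley S := by
      ext u v
      have : v - u = u + v := by linear_combination (-u) * h2
      simp [cayley, cayleySum, this]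
    rw [this]
    exact cayley_isConnected hS
  refine ⟨⟨0⟩, fun u v => ?_⟩
  have key : ∀ d ∈ AddSubmonoid.closure S, ∀ u,
      Relation.ReflTransGen (cayleySum S).Adj u (u + 2 * d) := by
    intro d hd
    induction hd using AddSubmonoid.closure_induction with
    | mem d hd =>
      intro u
      refine .tail (.single (b := -d - u) ?_) ?_
      · simpa [cayleySum] using hneg d hd
      · have : -d - u + (u + 2 * d) = d := by ring
        simpa only [cayleySum, this] using hd
    | zero => exact fun u => by rw [mul_zero, add_zero]
    | add a b _ _ iha ihb =>
      exact fun u => by rw [mul_add, ← add_assoc]; exact (iha u).trans (ihb _)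
  have := key (2⁻¹ * (v - u)) (hS ▸ AddSubmonoid.mem_top _) u
  rwa [mul_inv_cancel_left₀ h2, add_sub_cancel] at this

theorem cayley_isRegular {G : Type*} [AddCommGroup G] (S : Finset G) :
    IsRegular (cayley (S : Set G)) #S := by
  intro v
  constructor
  · rw [← Set.ncard_coe_finset]
    exact Set.ncard_congr (fun w _ => w - v) (fun w hw => hw)
      (fun a b _ _ h => sub_left_inj.1 h)
      (fun s hs => ⟨s + v, by simpa [cayley] using hs, by simp⟩)
  · rw [← Set.ncard_coe_finset]
    exact Set.ncard_congr (fun w _ => v - w) (fun w hw => hw)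
      (fun a b _ _ h => sub_right_inj.1 h)
      (fun s hs => ⟨v - s, by simpa [cayley] using hs, by simp⟩)

theorem cayleySum_isRegular {G : Type*} [AddCommGroup G] (S : Finset G) :
    IsRegular (cayleySum (S : Set G)) #S := by
  intro v
  constructor
  · rw [← Set.ncard_coe_finset]
    exact Set.ncard_congr (fun w _ => v + w) (fun w hw => hw)
      (fun a b _ _ h => add_left_cancel h)
      (fun s hs => ⟨s - v, by simpa [cayleySum] using hs, by simp⟩)
  · rw [← Set.ncard_coe_finset]
    exact Set.ncard_congr (fun w _ => w + v) (fun w hw => hw)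
      (fun a b _ _ h => add_right_cancel h)
      (fun s hs => ⟨s - v, by simpa [cayleySum] using hs, by simp⟩)

variable {F : Type*} [Field F] [Fintype F] [DecidableEq F]

theorem adjMatrix_cayley_mulVec (S : Finset F) (v : F → ℝ) (u : F) :
    (adjMatrix (cayley (S : Set F))).mulVec v u = ∑ s ∈ S, v (u + s) := by
  classical
  simp only [Matrix.mulVec, dotProduct, adjMatrix, cayley, Matrix.of_apply, ite_mul, one_mul,
    zero_mul, mem_coe]
  rw [← sum_filter]
  refine sum_bij' (fun w _ => w - u) (fun s _ => u + s) ?_ ?_ ?_ ?_ ?_ <;> simp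

theorem adjMatrix_cayleySum_mulVec (S : Finset F) (v : F → ℝ) (u : F) :
    (adjMatrix (cayleySum (S : Set F))).mulVec v u = ∑ s ∈ S, v (s - u) := by
  classical
  simp only [Matrix.mulVec, dotProduct, adjMatrix, cayleySum, Matrix.of_apply, ite_mul, one_mul,
    zero_mul, mem_coe]
  rw [← sum_filter]
  refine sum_bij' (fun w _ => u + w) (fun s _ => s - u) ?_ ?_ ?_ ?_ ?_ <;> simp

omit [DecidableEq F] in
theorem exists_fourier_ne_zero {ψ : AddChar F ℂ} (hψ : ψ.IsPrimitive) {v : F → ℝ} (hv : v ≠ 0) :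
    ∃ a, ∑ u, ψ (a * u) * v u ≠ 0 := by
  classical
  by_contra! h
  apply hv
  ext w
  have h1 : ∑ a, ψ (-(a * w)) * ∑ u, ψ (a * u) * v u = 0 := by simp [h]
  simp only [mul_sum] at h1
  rw [sum_comm] at h1
  have h2 : ∀ u, ∑ a, ψ (-(a * w)) * (ψ (a * u) * v u)
      = if u = w then (Fintype.card F : ℂ) * v u else 0 := by
    intro u
    simp only [← mul_assoc, ← AddChar.map_add_eq_mul, ← sum_mul]
    have e : ∀ a : F, -(a * w) + a * u = a * (u - w) := fun a => by ring
    simp only [e]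
    rw [AddChar.sum_mulShift _ hψ]
    simp only [sub_eq_zero]
    split_ifs <;> simp
  simp only [h2, sum_ite_eq', mem_univ, if_true] at h1
  simpa using h1

theorem isEigenvalue_iff {V : Type*} [Fintype V] [DecidableEq V] {G : Digraph V} {μ : ℝ} :
    IsEigenvalue G μ ↔ ∃ v : V → ℝ, v ≠ 0 ∧ ∀ u, (adjMatrix G).mulVec v u = μ * v u := by
  constructor
  · intro h
    obtain ⟨v, hv⟩ := h.exists_hasEigenvector
    refine ⟨v, hv.2, fun u => ?_⟩
    have := congrFun hv.apply_eq_smul u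
    simpa using this
  · rintro ⟨v, hv, h⟩
    refine Module.End.hasEigenvalue_of_hasEigenvector (x := v)
      (Module.End.hasEigenvector_iff.2 ⟨Module.End.mem_eigenspace_iff.2 ?_, hv⟩)
    ext u
    simpa using h u

/-- The eigenvalue of the Cayley graph of `S` at the character `x ↦ ψ (a x)`. -/
noncomputable def charSum (ψ : AddChar F ℂ) (S : Finset F) (a : F) : ℂ := ∑ s ∈ S, ψ (a * s)

omit [Fintype F] [DecidableEq F] in
theorem charSum_neg {S : Finset F} (hS : ∀ s ∈ S, -s ∈ S) (ψ : AddChar F ℂ) (a : F) :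
    charSum ψ S (-a) = charSum ψ S a := by
  unfold charSum
  exact sum_bij' (fun s _ => -s) (fun s _ => -s) hS hS (by simp) (by simp) (by simp)

omit [DecidableEq F] in
theorem charSum_eq_ofReal {S : Finset F} (hS : ∀ s ∈ S, -s ∈ S) (ψ : AddChar F ℂ) (a : F) :
    charSum ψ S a = ((charSum ψ S a).re : ℂ) := by
  refine (Complex.conj_eq_iff_re.1 ?_).symm
  conv_rhs => rw [← charSum_neg hS ψ a]
  simp only [charSum, map_sum, ← AddChar.map_neg_eq_conj, neg_mul]

theorem isEigenvalue_cayley {S : Finset F} (hS : ∀ s ∈ S, -s ∈ S) (ψ : AddChar F ℂ) (a : F) :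
    IsEigenvalue (cayley (S : Set F)) (charSum ψ S a).re := by
  -- The eigenvalue is real by symmetry of S, so the real part of a character is an eigenvector; it
  -- equals 1 at 0.
  refine isEigenvalue_iff.2 ⟨fun u => (ψ (a * u)).re, fun h => ?_, fun u => ?_⟩
  · simpa using congrFun h 0
  · rw [adjMatrix_cayley_mulVec, ← Complex.re_sum, ← Complex.re_ofReal_mul,
      ← charSum_eq_ofReal hS, charSum, sum_mul]
    simp only [mul_add, AddChar.map_add_eq_mul, mul_comm]

theorem isEigenvalue_cayleySum {S : Finset F} (hS : ∀ s ∈ S, -s ∈ S) (ψ : AddChar F ℂ) (a : F) :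
    IsEigenvalue (cayleySum (S : Set F)) (charSum ψ S a).re := by
  refine isEigenvalue_iff.2 ⟨fun u => (ψ (a * u)).re, fun h => ?_, fun u => ?_⟩
  · simpa using congrFun h 0
  · rw [adjMatrix_cayleySum_mulVec, ← Complex.re_sum]
    have h1 : (ψ (a * u)).re = (ψ (-(a * u))).re := by
      rw [AddChar.map_neg_eq_conj, Complex.conj_re]
    rw [show (charSum ψ S a).re * (fun u => (ψ (a * u)).re) u
        = (charSum ψ S a).re * (ψ (-(a * u))).re from congrArg _ h1,
      ← Complex.re_ofReal_mul, ← charSum_eq_ofReal hS, charSum, sum_mul]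
    refine congrArg _ (sum_congr rfl fun s _ => ?_)
    rw [← AddChar.map_add_eq_mul, mul_sub, sub_eq_add_neg]

theorem eq_charSum_of_isEigenvalue_cayley {S : Finset F} (hS : ∀ s ∈ S, -s ∈ S) {ψ : AddChar F ℂ}
    (hψ : ψ.IsPrimitive) {μ : ℝ} (h : IsEigenvalue (cayley (S : Set F)) μ) :
    ∃ a, μ = (charSum ψ S a).re := by
  obtain ⟨v, hv, hA⟩ := isEigenvalue_iff.1 h
  obtain ⟨a, ha⟩ := exists_fourier_ne_zero hψ hv
  refine ⟨a, ?_⟩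
  have h1 : ∑ u, ψ (a * u) * ((μ * v u : ℝ) : ℂ) = charSum ψ S (-a) * ∑ u, ψ (a * u) * v u := by
    simp only [← hA, adjMatrix_cayley_mulVec, charSum, Complex.ofReal_sum, sum_mul, mul_sum]
    rw [sum_comm]
    conv_rhs => rw [sum_comm]
    refine sum_congr rfl fun s _ => ?_
    rw [← Equiv.sum_comp (Equiv.subRight s)]
    refine sum_congr rfl fun u _ => ?_
    rw [Equiv.subRight_apply, sub_add_cancel, ← mul_assoc, ← AddChar.map_add_eq_mul]
    congr 2
    ring
  have h2 : ∑ u, ψ (a * u) * ((μ * v u : ℝ) : ℂ) = μ * ∑ u, ψ (a * u) * v u := by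
    rw [mul_sum]
    exact sum_congr rfl fun u _ => by push_cast; ring
  rw [h2, charSum_neg hS, charSum_eq_ofReal hS] at h1
  exact_mod_cast mul_right_cancel₀ ha h1

/-- The sum graph operator exchanges the Fourier coefficients at a and -a, scaling both by the same
λ_a. Applying it twice gives μ² = λ_a², which determines μ only up to sign. -/
theorem abs_eq_charSum_of_isEigenvalue_cayleySum {S : Finset F} (hS : ∀ s ∈ S, -s ∈ S)
    {ψ : AddChar F ℂ} (hψ : ψ.IsPrimitive) {μ : ℝ}
    (h : IsEigenvalue (cayleySum (S : Set F)) μ) :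
    ∃ a, |μ| = |(charSum ψ S a).re| := by
  obtain ⟨v, hv, hA⟩ := isEigenvalue_iff.1 h
  obtain ⟨a, ha⟩ := exists_fourier_ne_zero hψ hv
  refine ⟨a, ?_⟩
  have h1 : ∀ a, (μ : ℂ) * ∑ u, ψ (a * u) * v u
      = charSum ψ S a * ∑ u, ψ (-a * u) * v u := by
    intro a
    have h2 : ∑ u, ψ (a * u) * ((μ * v u : ℝ) : ℂ) = μ * ∑ u, ψ (a * u) * v u := by
      rw [mul_sum]
      exact sum_congr rfl fun u _ => by push_cast; ring
    rw [← h2]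
    simp only [← hA, adjMatrix_cayleySum_mulVec, charSum, Complex.ofReal_sum, sum_mul, mul_sum]
    rw [sum_comm]
    conv_rhs => rw [sum_comm]
    refine sum_congr rfl fun s _ => ?_
    rw [← Equiv.sum_comp (Equiv.subLeft s)]
    refine sum_congr rfl fun u _ => ?_
    rw [Equiv.subLeft_apply, sub_sub_cancel, ← mul_assoc, ← AddChar.map_add_eq_mul]
    congr 2
    ring
  have e1 := h1 a
  have e2 := h1 (-a)
  rw [neg_neg, charSum_neg hS] at e2
  rw [charSum_eq_ofReal hS] at e1 e2
  rw [← sq_eq_sq_iff_abs_eq_abs]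
  have : ((μ : ℂ) ^ 2) = ((charSum ψ S a).re : ℂ) ^ 2 := by
    apply mul_right_cancel₀ ha
    linear_combination (μ : ℂ) * e1 + ((charSum ψ S a).re : ℂ) * e2
  exact_mod_cast this

omit [Fintype F] [DecidableEq F] in
theorem charSum_zero (ψ : AddChar F ℂ) (S : Finset F) : charSum ψ S 0 = #S := by
  simp [charSum]

theorem IsRegular.unique {V : Type*} [Nonempty V] {G : Digraph V} {n n' : ℕ}
    (h : IsRegular G n) (h' : IsRegular G n') : n = n' := by
  obtain ⟨v⟩ := ‹Nonempty V›
  exact (h v).1.symm.trans (h' v).1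

theorem isRamanujan_cayley_iff {S : Finset F} (hS : ∀ s ∈ S, -s ∈ S)
    (hgen : AddSubmonoid.closure (S : Set F) = ⊤) {ψ : AddChar F ℂ} (hψ : ψ.IsPrimitive) :
    IsRamanujan (cayley (S : Set F)) ↔ ∀ a ≠ 0, |(charSum ψ S a).re| = #S ∨
      |(charSum ψ S a).re| ≤ 2 * √((#S : ℝ) - 1) := by
  constructor
  · rintro ⟨-, -, n, hn, h⟩ a -
    obtain rfl := hn.unique (cayley_isRegular S)
    exact h _ (isEigenvalue_cayley hS ψ a)
  · intro h
    refine ⟨fun u v huv => ?_, cayley_isConnected hgen, #S, cayley_isRegular S, fun μ hμ => ?_⟩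
    · have := hS _ huv
      rwa [neg_sub] at this
    · obtain ⟨a, rfl⟩ := eq_charSum_of_isEigenvalue_cayley hS hψ hμ
      by_cases ha : a = 0
      · left; simp [ha, charSum_zero]
      · exact h a ha

theorem isRamanujan_cayleySum_iff {S : Finset F} (hS : ∀ s ∈ S, -s ∈ S)
    (hgen : AddSubmonoid.closure (S : Set F) = ⊤) {ψ : AddChar F ℂ} (hψ : ψ.IsPrimitive) :
    IsRamanujan (cayleySum (S : Set F)) ↔ ∀ a ≠ 0, |(charSum ψ S a).re| = #S ∨
      |(charSum ψ S a).re| ≤ 2 * √((#S : ℝ) - 1) := by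
  constructor
  · rintro ⟨-, -, n, hn, h⟩ a -
    obtain rfl := hn.unique (cayleySum_isRegular S)
    exact h _ (isEigenvalue_cayleySum hS ψ a)
  · intro h
    refine ⟨fun u v huv => ?_, cayleySum_isConnected hgen hS, #S, cayleySum_isRegular S,
      fun μ hμ => ?_⟩
    · simpa only [cayleySum, add_comm] using huv
    · obtain ⟨a, ha⟩ := abs_eq_charSum_of_isEigenvalue_cayleySum hS hψ hμ
      rw [ha]
      by_cases ha : a = 0
      · left; simp [ha, charSum_zero]
      · exact h a ha

end CayleyGraphs

/-! ### Real inequalities, with x = √q. -/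

section Bounds

theorem abs_le_two_mul_sqrt {w z : ℝ} (h : w ^ 2 ≤ 4 * z) : |w| ≤ 2 * √z := by
  have : |w / 2| ≤ √z := Real.abs_le_sqrt (by linarith [show (w / 2) ^ 2 = w ^ 2 / 4 by ring])
  rw [abs_div, abs_two] at this
  linarith

theorem sq_le_of_abs_le_two_mul_sqrt {w z : ℝ} (hz : 0 ≤ z) (h : |w| ≤ 2 * √z) :
    w ^ 2 ≤ 4 * z := by
  rw [← sq_abs]
  calc |w| ^ 2 ≤ (2 * √z) ^ 2 := pow_le_pow_left₀ (abs_nonneg w) h 2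
    _ = 4 * z := by rw [mul_pow, Real.sq_sqrt hz]; ring

theorem abs_sub_one_div_le {k n x g : ℝ} (hk : 0 < k) (hn : x ^ 2 - 1 = k * n)
    (hg : |g| ≤ (k - 1) * x) (h : ((k - 1) * x + 1) ^ 2 ≤ 4 * k * (x ^ 2 - 1) - 4 * k ^ 2) :
    |(g - 1) / k| ≤ 2 * √(n - 1) := by
  apply abs_le_two_mul_sqrt
  rw [div_pow, div_le_iff₀ (by positivity)]
  have h1 : |g - 1| ≤ (k - 1) * x + 1 := by
    have := abs_sub g 1
    rw [abs_one] at this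
    linarith
  have h2 : (g - 1) ^ 2 ≤ ((k - 1) * x + 1) ^ 2 := by
    rw [← sq_abs]
    exact pow_le_pow_left₀ (abs_nonneg _) h1 2
  rw [hn] at h
  nlinarith

theorem abs_complement_le {k n x g : ℝ} (hk : 2 ≤ k) (hkx : k ≤ x)
    (hx : k = 2 ∧ 5 ≤ x ^ 2 ∨ 3 ≤ k) (hn : x ^ 2 - 1 = k * n) (hg : |g| ≤ (k - 1) * x) :
    |-1 - (g - 1) / k| ≤ 2 * √(x ^ 2 - 1 - n - 1) := by
  apply abs_le_two_mul_sqrt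
  have hk0 : k ≠ 0 := by positivity
  have e : -1 - (g - 1) / k = -((g + (k - 1)) / k) := by field_simp; ring
  rw [e, neg_sq, div_pow, div_le_iff₀ (by positivity)]
  have h1 : |g + (k - 1)| ≤ (k - 1) * (x + 1) := by
    have := abs_add_le g (k - 1)
    rw [abs_of_nonneg (show 0 ≤ k - 1 by linarith)] at this
    linarith
  have h2 : (g + (k - 1)) ^ 2 ≤ ((k - 1) * (x + 1)) ^ 2 := by
    rw [← sq_abs]
    exact pow_le_pow_left₀ (abs_nonneg _) h1 2
  have h3 : 4 * k ^ 2 ≤ (k - 1) * (x + 1) * ((3 * k + 1) * x - 5 * k + 1) := by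
    rcases hx with ⟨rfl, hx⟩ | hk3
    · nlinarith
    · have a1 : (k - 1) * (k + 1) ≤ (k - 1) * (x + 1) :=
        mul_le_mul_of_nonneg_left (by linarith) (by linarith)
      have a2 : 16 ≤ (3 * k + 1) * x - 5 * k + 1 := by nlinarith
      have a3 : 0 ≤ (k - 1) * (x + 1) := mul_nonneg (by linarith) (by linarith)
      nlinarith
  refine h2.trans ?_
  have : 4 * (x ^ 2 - 1 - n - 1) * k ^ 2 = 4 * k * (k - 1) * (x ^ 2 - 1) - 4 * k ^ 2 := by
    linear_combination (4 * k) * hn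
  rw [this]
  linarith [show 4 * k * (k - 1) * (x ^ 2 - 1) - ((k - 1) * (x + 1)) ^ 2
    = (k - 1) * (x + 1) * ((3 * k + 1) * x - 5 * k + 1) by ring]

/-- Here (k-1)² > 4k, so the extreme value overshoots 2√(n-1) whatever its sign, while k ≤ x keeps
it below the trivial value n. -/
theorem not_abs_sub_one_div_le {k n x g : ℝ} (hk : 6 ≤ k) (hkx : k ≤ x) (hn : x ^ 2 - 1 = k * n)
    (hn1 : 1 ≤ n) (hg : g ^ 2 = (k - 1) ^ 2 * x ^ 2) :
    ¬ (|(g - 1) / k| = n ∨ |(g - 1) / k| ≤ 2 * √(n - 1)) := by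
  have hk0 : 0 < k := by linarith
  have hgx : |g| = (k - 1) * x := by
    rw [← abs_of_nonneg (show 0 ≤ (k - 1) * x from mul_nonneg (by linarith) (by linarith)),
      ← sq_eq_sq_iff_abs_eq_abs, hg, mul_pow]
  rintro (h | h)
  · rw [abs_div, abs_of_pos hk0, div_eq_iff hk0.ne', mul_comm, ← hn] at h
    have := abs_sub g 1
    rw [abs_one, hgx, h] at this
    nlinarith
  · have := sq_le_of_abs_le_two_mul_sqrt (by linarith) h
    rw [div_pow, div_le_iff₀ (by positivity)] at this
    have h4 : 4 * (n - 1) * k ^ 2 = 4 * k * (x ^ 2 - 1) - 4 * k ^ 2 := by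
      linear_combination (-4 * k) * hn
    rw [h4] at this
    have hg1 : g ≤ (k - 1) * x := hgx ▸ le_abs_self g
    have h5 : 0 ≤ (k ^ 2 - 6 * k) * x ^ 2 := by
      have : 0 ≤ k ^ 2 - 6 * k := by nlinarith
      positivity
    nlinarith [sq_nonneg (x - (k - 1))]

end Bounds

/-! ### Arithmetic of semiprimitive pairs. -/

section Arithmetic

theorem IsSemiprimitivePair.cases {p m k : ℕ} (hp : p.Prime) (h : IsSemiprimitivePair k (p ^ m)) :
    0 < m ∧ ((k = 2 ∧ p ^ m ≡ 1 [MOD 4]) ∨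
      (2 < k ∧ Even m ∧ (∃ t : ℕ, t ∣ m / 2 ∧ k ∣ p ^ t + 1) ∧ k ≠ p ^ (m / 2) + 1)) := by
  obtain ⟨p', m', hp', hm', e, h⟩ := h
  have : p = p' := by
    have h1 : p' ∣ p ^ m := e ▸ dvd_pow_self p' hm'.ne'
    exact ((Nat.prime_dvd_prime_iff_eq hp' hp).1 (hp'.dvd_of_dvd_pow h1)).symm
  subst this
  have : m = m' := Nat.pow_right_injective hp.two_le e
  subst this
  exact ⟨hm', h⟩

theorem le_pow_half {p t s k : ℕ} (hp : 2 ≤ p) (ht : 0 < t) (hs : 0 < s)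
    (hk : k ∣ p ^ t + 1) (hne : k ≠ p ^ (t * s) + 1) : k ≤ p ^ (t * s) := by
  have h1 := Nat.le_of_dvd (Nat.succ_pos _) hk
  rcases Nat.lt_or_ge 1 s with h2 | h2
  · have hlt : p ^ t < p ^ (t * s) := Nat.pow_lt_pow_right (by omega) (by nlinarith)
    omega
  · obtain rfl : s = 1 := by omega
    rw [mul_one] at hne ⊢
    omega

/-- For k = 5 the bound k ≤ √q is too weak for the Ramanujan estimate, which fails at √q = 5 and 6.
Below 7 only p^t = 4 is possible, and then the exclusion 5 ≠ p^(ts) + 1 forces s > 1. -/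
theorem forty_nine_le {p t s : ℕ} (hp : p.Prime) (hk : 5 ∣ p ^ t + 1) (hs : 0 < s)
    (hne : 5 ≠ p ^ (t * s) + 1) : 49 ≤ p ^ (2 * (t * s)) := by
  have ht : 0 < t := Nat.pos_of_ne_zero (by rintro rfl; norm_num at hk)
  have h7 : 7 ≤ p ^ (t * s) := by
    by_cases h9 : 7 ≤ p ^ t
    · exact h9.trans (Nat.pow_le_pow_right hp.pos (Nat.le_mul_of_pos_right t hs))
    · have h4 : p ^ t = 4 := by omega
      rw [pow_mul, h4] at hne ⊢
      have : 1 < s := by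
        rcases Nat.lt_or_ge 1 s with h | h
        · exact h
        · obtain rfl : s = 1 := by omega
          simp at hne
      calc 7 ≤ 4 ^ 2 := by norm_num
        _ ≤ 4 ^ s := Nat.pow_le_pow_right (by norm_num) this
  rw [mul_comm, pow_mul]
  calc 49 = 7 ^ 2 := by norm_num
    _ ≤ _ := Nat.pow_le_pow_left h7 2

theorem pow_mod_five_odd {p : ℕ} (hp : p % 5 = 2 ∨ p % 5 = 3) (j : ℕ) :
    p ^ (2 * j + 1) % 5 = 2 ∨ p ^ (2 * j + 1) % 5 = 3 := by
  induction j with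
  | zero => simpa using hp
  | succ j ih =>
    have e : p ^ (2 * (j + 1) + 1) = p ^ (2 * j + 1) * (p * p) := by ring
    rw [e, Nat.mul_mod, Nat.mul_mod p p]
    rcases hp with h | h <;> rcases ih with h' | h' <;> simp [h, h']

theorem semiprimitive_small_list {p m k : ℕ} (hp : p.Prime) (hm : 0 < m) (hk2 : 2 < k)
    (hk5 : k ≤ 5) (hme : Even m) (ht : ∃ t : ℕ, t ∣ m / 2 ∧ k ∣ p ^ t + 1)
    (hne : k ≠ p ^ (m / 2) + 1) :
    (k = 3 ∧ p = 2 ∧ 4 ≤ m) ∨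
    (k = 3 ∧ p ≠ 2 ∧ p ≡ 2 [MOD 3] ∧ 2 ≤ m) ∨
    (k = 4 ∧ p = 3 ∧ 4 ≤ m) ∨
    (k = 4 ∧ p ≠ 3 ∧ p ≡ 3 [MOD 4] ∧ 2 ≤ m) ∨
    (k = 5 ∧ p = 2 ∧ 8 ≤ m ∧ 4 ∣ m) ∨
    (k = 5 ∧ p ≠ 2 ∧ (p ≡ 2 [MOD 5] ∨ p ≡ 3 [MOD 5]) ∧ 4 ≤ m ∧ 4 ∣ m) ∨
    (k = 5 ∧ p ≡ 4 [MOD 5] ∧ 2 ≤ m ∧ Even m) := by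
  obtain ⟨t, htm, htk⟩ := ht
  obtain ⟨r, hr⟩ := hme
  have hm2 : m / 2 = r := by omega
  rw [hm2] at htm hne
  have hr0 : 0 < r := by omega
  have ht0 : t ≠ 0 := by rintro rfl; rw [zero_dvd_iff] at htm; omega
  have hmod : ∀ a, p % k = a → (a ^ t + 1) % k = 0 := by
    rintro a rfl
    rw [Nat.add_mod, ← Nat.pow_mod, ← Nat.add_mod]
    exact Nat.mod_eq_zero_of_dvd htk
  have h0 : p % k ≠ 0 := by
    intro h
    have := hmod 0 h
    rw [zero_pow ht0, Nat.mod_eq_of_lt (by omega)] at this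
    omega
  have h1 : p % k ≠ 1 := by
    intro h
    have := hmod 1 h
    rw [one_pow, Nat.mod_eq_of_lt (by omega)] at this
    omega
  have hlt := Nat.mod_lt p (show k > 0 by omega)
  simp only [Nat.ModEq]
  obtain rfl | rfl | rfl : k = 3 ∨ k = 4 ∨ k = 5 := by omega
  · have h2 : p % 3 = 2 := by omega
    by_cases hp2 : p = 2
    · subst hp2
      have : r ≠ 1 := by rintro rfl; simp at hne
      left; omega
    · right; left; omega
  · have h2 : p % 4 ≠ 2 := by
      intro h
      have h3 := hmod 2 h
      obtain ⟨j, rfl⟩ := Nat.exists_eq_succ_of_ne_zero ht0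
      rw [Nat.succ_eq_add_one, pow_succ] at h3
      omega
    by_cases hp3 : p = 3
    · subst hp3
      have : r ≠ 1 := by rintro rfl; simp at hne
      right; right; left; omega
    · right; right; right; left; omega
  · by_cases h4 : p % 5 = 4
    · right; right; right; right; right; right
      exact ⟨rfl, h4, by omega, r, hr⟩
    · have h23 : p % 5 = 2 ∨ p % 5 = 3 := by omega
      -- If p ≡ ±2 mod 5, odd powers of p stay ±2 and never reach -1; so t is even and 4 ∣ m.
      have hte : 2 ∣ t := by
        by_contra hodd
        obtain ⟨j, rfl⟩ : ∃ j, t = 2 * j + 1 := ⟨t / 2, by omega⟩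
        have := pow_mod_five_odd h23 j
        omega
      have h4m : 4 ∣ m := by
        have := hte.trans htm
        omega
      by_cases hp2 : p = 2
      · subst hp2
        have : r ≠ 2 := by rintro rfl; simp at hne
        right; right; right; right; left; omega
      · right; right; right; right; right; left; omega

end Arithmetic

/-! ### The Ramanujan criteria in terms of power sums. -/

section Semiprimitive

variable {F : Type*} [Field F] [Fintype F] [DecidableEq F]

omit [DecidableEq F] in
theorem neg_one_pow_eq_one {p m e : ℕ} (hp : p.Prime) (hF : Fintype.card F = p ^ m)
    (he : p ≠ 2 → Even e) : (-1 : F) ^ e = 1 := by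
  by_cases h2 : p = 2
  · have : CharP F 2 := h2 ▸ charP_of_card_eq hp hF
    rw [CharTwo.neg_eq, one_pow]
  · exact (he h2).neg_one_pow

theorem charSum_powers {k : ℕ} (hk : k ∣ Fintype.card F - 1) (ψ : AddChar F ℂ) (a : F) :
    (charSum ψ (powers k F) a).re = (rePowSum ψ k a - 1) / k := by
  have hq := Fintype.one_lt_card (α := F)
  have hk0 : (k : ℝ) ≠ 0 := by
    rw [Nat.cast_ne_zero]
    rintro rfl
    simp at hk; omega
  have h := sum_univ_pow hk (fun y => ψ (a * y))
  rw [mul_zero, AddChar.map_zero_eq_one, nsmul_eq_mul] at h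
  have h' := congrArg Complex.re h
  rw [Complex.add_re, Complex.one_re, ← Complex.ofReal_natCast, Complex.re_ofReal_mul] at h'
  rw [eq_div_iff hk0, charSum, rePowSum, powSum, h']
  ring

/-- The nonzero elements that are not `k`-th powers. -/
def nonPowers (k : ℕ) (F : Type*) [Field F] [Fintype F] [DecidableEq F] : Finset F :=
  univ.erase 0 \ powers k F

theorem complement_paley (k : ℕ) : complement (paley k F) = cayley (nonPowers k F : Set F) := by
  ext u v
  simp only [complement, paley, cayley, nonPowers, ← coe_powers, mem_coe, mem_sdiff, mem_erase,
    mem_univ, and_true, sub_ne_zero, ne_comm (a := u)]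

theorem powers_subset (k : ℕ) : powers k F ⊆ univ.erase 0 := by
  intro y hy
  obtain ⟨x, hx, rfl⟩ := mem_powers.1 hy
  exact mem_erase.2 ⟨pow_ne_zero _ hx, mem_univ _⟩

theorem card_nonPowers {k n : ℕ} (h : Fintype.card F - 1 = k * n) :
    (#(nonPowers k F) : ℝ) = Fintype.card F - 1 - n := by
  have hq := Fintype.one_lt_card (α := F)
  have := card_sdiff_add_card_eq_card (powers_subset (F := F) k)
  rw [card_powers h, card_erase_of_mem (mem_univ _), card_univ] at this
  have h2 : ((#(nonPowers k F) + n : ℕ) : ℝ) = ((Fintype.card F - 1 : ℕ) : ℝ) := by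
    rw [nonPowers, this]
  rw [Nat.cast_sub hq.le, Nat.cast_one] at h2
  push_cast at h2
  linarith

theorem charSum_nonPowers {ψ : AddChar F ℂ} (hψ : ψ.IsPrimitive) (k : ℕ) {a : F} (ha : a ≠ 0) :
    (charSum ψ (nonPowers k F) a).re = -1 - (charSum ψ (powers k F) a).re := by
  have h1 := sum_sdiff (f := fun s => ψ (a * s)) (powers_subset (F := F) k)
  have h2 := sum_erase_add univ (fun s => ψ (a * s)) (mem_univ (0 : F))
  have h3 := AddChar.sum_mulShift a hψ
  simp only [ha, if_false, Nat.cast_zero, mul_comm _ a] at h3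
  rw [h3, mul_zero, AddChar.map_zero_eq_one] at h2
  have h4 : charSum ψ (nonPowers k F) a = -1 - charSum ψ (powers k F) a := by
    unfold charSum nonPowers
    linear_combination h1 + h2
  rw [h4]
  simp

variable {k n : ℕ}

theorem neg_mem_nonPowers (hk : k ≠ 0) (hneg : ∃ z : F, z ^ k = -1) :
    ∀ s ∈ nonPowers k F, -s ∈ nonPowers k F := by
  intro s hs
  simp only [nonPowers, mem_sdiff, mem_erase, mem_univ, and_true] at hs ⊢
  exact ⟨neg_ne_zero.2 hs.1, fun h => hs.2 (by simpa using neg_mem_powers hk hneg h)⟩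

/-- The complement of R_k contains a whole coset gR_k, and multiplication by g is an additive
automorphism. -/
theorem closure_nonPowers (hk : 2 ≤ k) (h : Fintype.card F - 1 = k * n)
    (hneg : ∃ z : F, z ^ k = -1) (hkq : k ^ 2 ≤ Fintype.card F) :
    AddSubmonoid.closure (nonPowers k F : Set F) = ⊤ := by
  have hq := Fintype.one_lt_card (α := F)
  have hn : 0 < n := Nat.pos_of_ne_zero (by rintro rfl; omega)
  obtain ⟨g, hg⟩ : (nonPowers k F).Nonempty := by
    rw [nonPowers, ← card_pos]
    have := card_sdiff_add_card_eq_card (powers_subset (F := F) k)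
    rw [card_powers h, card_erase_of_mem (mem_univ _), card_univ] at this
    nlinarith
  simp only [nonPowers, mem_sdiff, mem_erase, mem_univ, and_true] at hg
  refine closure_of_mul_subset (closure_powers hk h hneg hkq) hg.1 fun y hy => ?_
  obtain ⟨x, hx, rfl⟩ := mem_powers.1 hy
  simp only [nonPowers, coe_sdiff, Set.mem_sdiff, mem_coe, mem_erase, mem_univ, and_true]
  refine ⟨mul_ne_zero hg.1 (pow_ne_zero _ hx), fun hmem => hg.2 ?_⟩
  obtain ⟨z, hz, hzx⟩ := mem_powers.1 hmem
  refine mem_powers.2 ⟨z / x, div_ne_zero hz hx, ?_⟩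
  rw [div_pow, hzx, mul_div_assoc, div_self (pow_ne_zero _ hx), mul_one]

theorem isRamanujan_paley_iff (hk : 2 ≤ k) (h : Fintype.card F - 1 = k * n)
    (hneg : ∃ z : F, z ^ k = -1) (hkq : k ^ 2 ≤ Fintype.card F) {ψ : AddChar F ℂ}
    (hψ : ψ.IsPrimitive) :
    IsRamanujan (paley k F) ↔ ∀ a ≠ 0, |(rePowSum ψ k a - 1) / k| = n ∨
      |(rePowSum ψ k a - 1) / k| ≤ 2 * √((n : ℝ) - 1) := by
  have := isRamanujan_cayley_iff (fun s hs => neg_mem_powers (by omega) hneg hs)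
    (closure_powers hk h hneg hkq) hψ
  rw [card_powers h] at this
  simp only [charSum_powers ⟨n, h⟩] at this
  rw [paley, ← coe_powers, this]

theorem isRamanujan_paleySum_iff (hk : 2 ≤ k) (h : Fintype.card F - 1 = k * n)
    (hneg : ∃ z : F, z ^ k = -1) (hkq : k ^ 2 ≤ Fintype.card F) {ψ : AddChar F ℂ}
    (hψ : ψ.IsPrimitive) :
    IsRamanujan (paleySum k F) ↔ ∀ a ≠ 0, |(rePowSum ψ k a - 1) / k| = n ∨
      |(rePowSum ψ k a - 1) / k| ≤ 2 * √((n : ℝ) - 1) := by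
  have := isRamanujan_cayleySum_iff (fun s hs => neg_mem_powers (by omega) hneg hs)
    (closure_powers hk h hneg hkq) hψ
  rw [card_powers h] at this
  simp only [charSum_powers ⟨n, h⟩] at this
  rw [paleySum, ← coe_powers, this]

theorem abs_rePowSum_le {ψ : AddChar F ℂ} (hψ : ψ.IsPrimitive) (hk : 2 ≤ k)
    (h : Fintype.card F - 1 = k * n) (hneg : ∃ z : F, z ^ k = -1) {a : F} (ha : a ≠ 0) :
    |rePowSum ψ k a| ≤ (k - 1) * √(Fintype.card F : ℝ) := by
  have hk' : (2 : ℝ) ≤ k := by exact_mod_cast hk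
  apply abs_le_of_sq_le_sq _ (mul_nonneg (by linarith) (Real.sqrt_nonneg _))
  rw [mul_pow, Real.sq_sqrt (Nat.cast_nonneg _)]
  exact rePowSum_sq_le hψ hk h hneg ha

omit [Field F] [DecidableEq F] in
theorem le_sqrt_card (hkq : k ^ 2 ≤ Fintype.card F) : (k : ℝ) ≤ √(Fintype.card F : ℝ) :=
  Real.le_sqrt_of_sq_le (by exact_mod_cast hkq)

omit [DecidableEq F] in
theorem sqrt_card_sq_sub_one (h : Fintype.card F - 1 = k * n) :
    √(Fintype.card F : ℝ) ^ 2 - 1 = k * n := by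
  have hq := Fintype.one_lt_card (α := F)
  rw [Real.sq_sqrt (Nat.cast_nonneg _), ← Nat.cast_mul, ← h, Nat.cast_sub hq.le, Nat.cast_one]

theorem isRamanujan_complement_paley (hk : 2 ≤ k) (h : Fintype.card F - 1 = k * n)
    (hneg : ∃ z : F, z ^ k = -1) (hkq : k ^ 2 ≤ Fintype.card F)
    (h2 : k = 2 → 5 ≤ Fintype.card F) {ψ : AddChar F ℂ} (hψ : ψ.IsPrimitive) :
    IsRamanujan (complement (paley k F)) := by
  rw [complement_paley, isRamanujan_cayley_iff (neg_mem_nonPowers (by omega) hneg)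
    (closure_nonPowers hk h hneg hkq) hψ]
  intro a ha
  right
  rw [charSum_nonPowers hψ k ha, charSum_powers ⟨n, h⟩, card_nonPowers h]
  have hsq : √(Fintype.card F : ℝ) ^ 2 = Fintype.card F := Real.sq_sqrt (Nat.cast_nonneg _)
  rw [← hsq]
  refine abs_complement_le (by exact_mod_cast hk) (le_sqrt_card hkq) ?_ (sqrt_card_sq_sub_one h)
    (abs_rePowSum_le hψ hk h hneg ha)
  rcases hk.eq_or_lt with rfl | hk
  · left; rw [hsq]; exact ⟨by norm_num, by exact_mod_cast h2 rfl⟩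
  · right; exact_mod_cast hk

theorem abs_rePowSum_sub_one_div_le (hk : 2 ≤ k) (hk5 : k ≤ 5) (h : Fintype.card F - 1 = k * n)
    (hneg : ∃ z : F, z ^ k = -1) (hkq : k ^ 2 ≤ Fintype.card F)
    (h2 : k = 2 → 5 ≤ Fintype.card F) (h5 : k = 5 → 49 ≤ Fintype.card F) {ψ : AddChar F ℂ}
    (hψ : ψ.IsPrimitive) {a : F} (ha : a ≠ 0) :
    |(rePowSum ψ k a - 1) / k| ≤ 2 * √((n : ℝ) - 1) := by
  have hsq : √(Fintype.card F : ℝ) ^ 2 = Fintype.card F := Real.sq_sqrt (Nat.cast_nonneg _)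
  have hx := le_sqrt_card hkq
  refine abs_sub_one_div_le (by positivity) (sqrt_card_sq_sub_one h)
    (abs_rePowSum_le hψ hk h hneg ha) ?_
  set x := √(Fintype.card F : ℝ)
  obtain rfl | rfl | rfl | rfl : k = 2 ∨ k = 3 ∨ k = 4 ∨ k = 5 := by omega
  · have : (5 : ℝ) ≤ x ^ 2 := by rw [hsq]; exact_mod_cast h2 rfl
    push_cast at hx ⊢
    nlinarith
  · push_cast at hx ⊢
    nlinarith
  · push_cast at hx ⊢
    nlinarith
  · have : (49 : ℝ) ≤ x ^ 2 := by rw [hsq]; exact_mod_cast h5 rfl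
    have h7 : 7 ≤ x := Real.le_sqrt_of_sq_le (by rw [hsq] at this; norm_num at this ⊢; exact this)
    push_cast
    nlinarith

omit [DecidableEq F] in
theorem not_ramanujan_bound (hk : 6 ≤ k) (h : Fintype.card F - 1 = k * n)
    (hkq : k ^ 2 ≤ Fintype.card F) {ψ : AddChar F ℂ} {a : F}
    (hsq : rePowSum ψ k a ^ 2 = (k - 1) ^ 2 * Fintype.card F) :
    ¬ (|(rePowSum ψ k a - 1) / k| = n ∨
      |(rePowSum ψ k a - 1) / k| ≤ 2 * √((n : ℝ) - 1)) := by
  have hq := Fintype.one_lt_card (α := F)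
  have hn : 1 ≤ n := Nat.pos_of_ne_zero (by rintro rfl; omega)
  refine not_abs_sub_one_div_le (by exact_mod_cast hk) (le_sqrt_card hkq) (sqrt_card_sq_sub_one h)
    (by exact_mod_cast hn) ?_
  rw [hsq, Real.sq_sqrt (Nat.cast_nonneg _)]

-- With Q = p^t, both Q + 1 and Q - 1 divide q - 1 with cofactor even for odd p, because Q² - 1
-- divides q - 1. Hence -1 is a power of either exponent, and a^(Q-1) = -1 gives a^Q = -a.
omit [DecidableEq F] in
theorem exists_pow_eq_neg {p t s : ℕ} (hp : p.Prime)
    (hF : Fintype.card F = p ^ (2 * t * s)) :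
    p ^ t + 1 ∣ Fintype.card F - 1 ∧ (∃ z : F, z ^ (p ^ t + 1) = -1) ∧
      ∃ a : F, a ≠ 0 ∧ a ^ p ^ t = -a := by
  obtain ⟨c, hc⟩ : (p ^ t + 1) * (p ^ t - 1) ∣ Fintype.card F - 1 := by
    rw [hF, pow_mul p (2 * t) s, ← Nat.sq_sub_sq, ← pow_mul, mul_comm t 2, one_pow]
    simpa using Nat.sub_dvd_pow_sub_pow (p ^ (2 * t)) 1 s
  have hodd : p ≠ 2 → Odd (p ^ t) := fun h => (hp.odd_of_ne_two h).pow
  have hQ : 1 ≤ p ^ t := Nat.one_le_pow _ _ hp.pos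
  refine ⟨⟨(p ^ t - 1) * c, by rw [hc, mul_assoc]⟩, ?_, ?_⟩
  · obtain ⟨z, -, hz⟩ := exists_pow_eq (k := p ^ t + 1) (n := (p ^ t - 1) * c)
      (by rw [hc, mul_assoc])
      (neg_one_pow_eq_one hp hF fun h => ((hodd h).tsub_odd odd_one).mul_right c)
    exact ⟨z, hz⟩
  · obtain ⟨a, ha, haz⟩ := exists_pow_eq (k := p ^ t - 1) (n := (p ^ t + 1) * c)
      (by rw [hc]; ring)
      (neg_one_pow_eq_one hp hF fun h => ((hodd h).add_odd odd_one).mul_right c)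
    refine ⟨a, ha, ?_⟩
    rw [← Nat.sub_add_cancel hQ, pow_succ, haz, neg_one_mul]

end Semiprimitive


end GPGraph

/-! ### The main theorem. -/

open GPGraph in
theorem theorem6p1 {F : Type*} [Field F] [Fintype F] [DecidableEq F] (p m k : ℕ)
    (hp : p.Prime) (hF : Fintype.card F = p ^ m)
    (hk : GPGraph.IsSemiprimitivePair k (p ^ m)) :
    (GPGraph.IsRamanujan (GPGraph.paley k F) ↔ GPGraph.IsRamanujan (GPGraph.paleySum k F)) ∧
    (GPGraph.IsRamanujan (GPGraph.paley k F) ↔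
      ((k = 2 ∧ p ^ m ≡ 1 [MOD 4]) ∨
        (Even m ∧
          ((k = 3 ∧ p = 2 ∧ 4 ≤ m) ∨
            (k = 3 ∧ p ≠ 2 ∧ p ≡ 2 [MOD 3] ∧ 2 ≤ m) ∨
            (k = 4 ∧ p = 3 ∧ 4 ≤ m) ∨
            (k = 4 ∧ p ≠ 3 ∧ p ≡ 3 [MOD 4] ∧ 2 ≤ m) ∨
            (k = 5 ∧ p = 2 ∧ 8 ≤ m ∧ 4 ∣ m) ∨
            (k = 5 ∧ p ≠ 2 ∧ (p ≡ 2 [MOD 5] ∨ p ≡ 3 [MOD 5]) ∧ 4 ≤ m ∧ 4 ∣ m) ∨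
            (k = 5 ∧ p ≡ 4 [MOD 5] ∧ 2 ≤ m ∧ Even m))))) ∧
    GPGraph.IsRamanujan (GPGraph.complement (GPGraph.paley k F)) := by
  have hq := Fintype.one_lt_card (α := F)
  obtain ⟨ψ, hψ, hfrob, hone⟩ := exists_primitive_addChar F hp hF
  obtain ⟨hm, ⟨rfl, hmod⟩ | ⟨hk2, hme, ⟨t, htm, htk⟩, hne⟩⟩ := hk.cases hp
  · have hmod' : Fintype.card F % 4 = 1 := by rw [hF]; exact hmod
    -- The degree n = 2j is even, which is what makes -1 a square.
    obtain ⟨j, hj⟩ : ∃ j, Fintype.card F - 1 = 2 * (2 * j) := ⟨Fintype.card F / 4, by omega⟩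
    have hneg : ∃ z : F, z ^ 2 = -1 := by
      obtain ⟨z, -, hz⟩ := exists_pow_eq hj (neg_one_pow_eq_one hp hF fun _ => even_two_mul j)
      exact ⟨z, hz⟩
    have h5 : 5 ≤ Fintype.card F := by omega
    have hkq : 2 ^ 2 ≤ Fintype.card F := by omega
    have hbound : ∀ a : F, a ≠ 0 →
        |(rePowSum ψ 2 a - 1) / (2 : ℕ)| ≤ 2 * √(((2 * j : ℕ) : ℝ) - 1) := fun a ha =>
      abs_rePowSum_sub_one_div_le le_rfl (by norm_num) hj hneg hkq (fun _ => h5)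
        (fun h => by omega) hψ ha
    have hR := (isRamanujan_paley_iff le_rfl hj hneg hkq hψ).2 fun a ha => Or.inr (hbound a ha)
    have hRs := (isRamanujan_paleySum_iff le_rfl hj hneg hkq hψ).2 fun a ha => Or.inr (hbound a ha)
    exact ⟨iff_of_true hR hRs, iff_of_true hR (Or.inl ⟨rfl, hmod⟩),
      isRamanujan_complement_paley le_rfl hj hneg hkq (fun _ => h5) hψ⟩
  · obtain ⟨s, hs⟩ := htm
    have hm2 : m = 2 * (t * s) := by
      obtain ⟨r, rfl⟩ := hme
      omega
    have hs0 : 0 < s := Nat.pos_of_ne_zero (by rintro rfl; omega)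
    have ht0 : 0 < t := Nat.pos_of_ne_zero (by rintro rfl; omega)
    obtain ⟨hdvd, hnegK, a, ha, hat⟩ :=
      exists_pow_eq_neg (F := F) (s := s) hp (by rw [hF, hm2, mul_assoc])
    obtain ⟨n, hn⟩ := htk.trans hdvd
    have hneg : ∃ z : F, z ^ k = -1 := by
      obtain ⟨N, hN⟩ := htk
      obtain ⟨z, hz⟩ := hnegK
      exact ⟨z ^ N, by rw [← pow_mul, mul_comm, ← hN, hz]⟩
    have hkq : k ^ 2 ≤ Fintype.card F := by
      rw [hF, hm2, mul_comm 2, pow_mul]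
      exact Nat.pow_le_pow_left (le_pow_half hp.two_le ht0 hs0 htk (hs ▸ hne)) 2
    have hdm : 2 * t ∣ m := ⟨s, by rw [hm2, mul_assoc]⟩
    have hP := isRamanujan_paley_iff hk2.le hn hneg hkq hψ
    have hS := isRamanujan_paleySum_iff hk2.le hn hneg hkq hψ
    have hlarge : IsRamanujan (paley k F) → k ≤ 5 := by
      intro hR
      by_contra hk6
      exact not_ramanujan_bound (by omega) hn hkq
        (exists_rePowSum_sq_eq hψ hp hF hdm hfrob (fun c => hone t c hdm) hnegK ha hat htk)
        (hP.1 hR a ha)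
    have h5 : k = 5 → 49 ≤ Fintype.card F := by
      rintro rfl
      rw [hF, hm2]
      exact forty_nine_le hp htk hs0 (hs ▸ hne)
    have hsmall : k ≤ 5 → IsRamanujan (paley k F) := fun hk5 => hP.2 fun a ha =>
      Or.inr (abs_rePowSum_sub_one_div_le hk2.le hk5 hn hneg hkq (fun h => by omega) h5 hψ ha)
    refine ⟨hP.trans hS.symm, ⟨fun hR => Or.inr ⟨hme, ?_⟩, fun hl => hsmall ?_⟩,
      isRamanujan_complement_paley hk2.le hn hneg hkq (fun h => by omega) hψ⟩
    · exact semiprimitive_small_list hp hm hk2 (hlarge hR) hme ⟨t, ⟨s, hs⟩, htk⟩ hne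
    -- Every listed case has k ≤ 5, and nothing more is needed for this direction.
    · omega
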